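/- **Setting.** Let $M\ge 2$, $\Upsilon=\Upsilon_\sigma\times\Upsilon_\gamma\times\Upsilon_E\times\Upsilon_z=[-\tfrac12,\tfrac12]^{N_\sigma+N_\gamma+2M}$ (with $\Upsilon_E,\Upsilon_z=[-\frac12,\frac12]^M$), $y=(y_\sigma,y_\gamma,y_E,y_z)\in\Upsilon$, and let $L,\omega>0$. - $y_\gamma\mapsto\gamma(\cdot,y_\gamma)$ is a continuous map into the $L$-periodic functions in $C^{0,1}(\mathbb R;\mathbb R^2)$, each $\gamma(\cdot,y_\gamma)$ parametrizing a closed, non-self-intersecting Lipschitz curve $\Gamma^y$ counterclockwise. $D^y$ (also written $D(y_\gamma)$) is the domain enclosed by $\Gamma^y$, and $\Phi(\cdot,y_\gamma):D(y_\gamma)\to D(0)$ is a bi-Lipschitz homeomorphism. - $y_E\mapsto\theta(y_E)\in[0,L)^M$ is continuous (with $L$ identified with $0$). With $\mathrm{dist}$ the counterclockwise distance along the curve, $\mathrm{dist}(\gamma(\theta_j(y_E),y_\gamma),\gamma(\theta_k(y_E),y_\gamma))>\omega$ for all $j\ne k$, $y_E$, $y_\gamma$. The electrodes are $E^y_m=\{x\in\Gamma^y: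 0<\mathrm{dist}(\gamma(\theta_m(y_E),y_\gamma),x)<\omega\}$, $m=1,\dots,M$. - $y_\sigma\mapsto\sigma_0(\cdot,y_\sigma)\in L^\infty(D(0))$ is continuous with $\operatorname{ess\,inf}\sigma_0(\cdot,y_\sigma)>0$, and $\sigma^y=\sigma_0(\Phi(\cdot,y_\gamma),y_\sigma)$. The map $y_z\mapsto z^y=z(y_z)\in(0,\infty)^M$ is continuous. Let $\varsigma_-=\min_{y_\sigma}\operatorname{ess\,inf}\sigma_0(\cdot,y_\sigma)$, $\varsigma_+=\max_{y_\sigma}\|\sigma_0(\cdot,y_\sigma)\|_{L^\infty(D(0))}$, $\zeta_-=\min_m\min_{y_z}z_m(y_z)$, $\zeta_+=\max_m\max_{y_z}z_m(y_z)$. Let $C_{\rm tr}$ be the supremum over $y\in\Upsilon$ of the norms of the trace operators $H^1(D^y)\to L^2(\Gamma^y)$, and $C_{\rm P}$ the supremum over $y\in\Upsilon$ of the smallest constants $C_{y,{\rm P}}$ with $\|v-\bar v\|_{H^1(D^y)}\le C_{y,{\rm P}}\|\nabla v\|_{L^2(D^y)}$ for all $v\in H^1(D^y)$, where $\bar v$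 is the mean of $v$ over $D^y$. Let $\mathcal H^y=(H^1(D^y)\oplus\mathbb R^M)/\mathbb R$ be the quotient by the pairs $(c,c\mathbf 1)$, $c\in\mathbb R$, $\mathbf 1=(1,\dots,1)$, with the norm $\|(v,V)\|_{\mathcal H^y}^2=\inf_{c\in\mathbb R}\big(\|v-c\|_{H^1(D^y)}^2+|V-c\mathbf 1|^2\big)$. **Theorem.** Assume that the trace operators are defined on all of $H^1(D^y)$ and that $C_{\rm tr}<\infty$ and $C_{\rm P}<\infty$. Then $\varsigma_->0$, $\zeta_->0$, and for every $y\in\Upsilon$ the formula $$B^y\big((w,W),(v,V)\big)=\int_{D^y}\sigma^y\,\nabla w\cdot\nabla v\,dx+\sum_{m=1}^M\frac1{z^y_m}\int_{E^y_m}(W_m-w)(V_m-v)\,dS$$ gives a well-defined bilinear form $B^y:\mathcal H^y\times\mathcal H^y\to\mathbb R$ such that, for all $(w,W),(v,V)\in\mathcal H^y$, $$\big|B^y\big((w,W),(v,V)\big)\big|\le\max\Big\{\varsigma_++\frac{2C_{\rm tr}^2}{\zeta_-},\frac{2\omega}{\zeta_-}\Big\}\|(w,W)\|_{\mathcal H^y}\|(v,V)\|_{\mathcal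 H^y},$$ $$B^y\big((v,V),(v,V)\big)\ge\Big(\max\Big\{\frac{C_{\rm P}^2}{\varsigma_-}\Big(1+\frac{2C_{\rm tr}^2}{\omega}\Big),\frac{2\zeta_+}{\omega}\Big\}\Big)^{-1}\|(v,V)\|_{\mathcal H^y}^2 .$$ -/

import Mathlib

open MeasureTheory Set Filter Topology
open scoped ENNReal NNReal ContDiff

noncomputable section

namespace CEM

/-- The Euclidean plane. -/
abbrev Plane : Type := EuclideanSpace ℝ (Fin 2)

/-- The parameter hypercube `[-1/2, 1/2]^n`. -/
abbrev Cube (n : ℕ) : Type := Fin n → Set.Icc (-(1 / 2) : ℝ) (1 / 2)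

/-- The centre of the hypercube. -/
def Cube.zero (n : ℕ) : Cube n := fun _ => ⟨0, by norm_num, by norm_num⟩

/-! ### Closed curves in the plane -/

/-- The trace of an `L`-periodic curve. -/
def image (γ : ℝ → Plane) (L : ℝ) : Set Plane := γ '' Ico 0 L

/-- The domain enclosed by a closed curve: the points off the curve whose connected component
in the complement of the curve is bounded. -/
def enclosed (γ : ℝ → Plane) (L : ℝ) : Set Plane :=
  {x | x ∈ (image γ L)ᶜ ∧ Bornology.IsBounded (connectedComponentIn (image γ L)ᶜ x)}

/-- The arc length measure `dS` of a curve, so that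
`∫ f dS = ∫_0^L f (γ t) |γ'(t)| dt`. -/
def arcMeasure (γ : ℝ → Plane) (L : ℝ) : Measure Plane :=
  ((volume.restrict (Ico 0 L)).withDensity (fun t => ‖deriv γ t‖ₑ)).map γ

/-- The distance along the closed curve, in the direction of the parametrization,
from `γ s` to `γ t`. -/
def arcDist (γ : ℝ → Plane) {L : ℝ} (hL : 0 < L) (s t : ℝ) : ℝ :=
  ∫ r in s..toIcoMod hL s t, ‖deriv γ r‖

/-- `γ` is an `L`-periodic Lipschitz parametrization of a closed curve without self-intersections,
traversed counterclockwise (its signed area `½ ∮ (x₀ dx₁ - x₁ dx₀)` is positive). -/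
structure IsLipschitzJordan (γ : ℝ → Plane) (L : ℝ) : Prop where
  periodic : Function.Periodic γ L
  lipschitz : ∃ K : ℝ≥0, LipschitzWith K γ
  injOn : InjOn γ (Ico 0 L)
  counterclockwise :
    0 < (1 / 2) * ∫ t in (0 : ℝ)..L, (γ t 0 * deriv γ t 1 - γ t 1 * deriv γ t 0)

/-! ### The Sobolev space `H¹` -/

/-- `g` is the weak gradient of `v` in `D`. -/
def IsWeakGradient (D : Set Plane) (v : Plane → ℝ) (g : Plane → Plane) : Prop :=
  ∀ φ : Plane → ℝ, ContDiff ℝ ∞ φ → HasCompactSupport φ → tsupport φ ⊆ D →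
    ∫ x in D, v x • gradient φ x = - ∫ x in D, φ x • g x

theorem continuous_gradient {φ : Plane → ℝ} (hφ : ContDiff ℝ ∞ φ) : Continuous (gradient φ) :=
  (InnerProductSpace.toDual ℝ Plane).symm.continuous.comp
    (hφ.continuous_fderiv (by simp))

theorem hasCompactSupport_gradient {φ : Plane → ℝ} (hc : HasCompactSupport φ) :
    HasCompactSupport (gradient φ) :=
  (hc.fderiv ℝ).comp_left (g := (InnerProductSpace.toDual ℝ Plane).symm) (map_zero _)

theorem integrable_smul_gradient {D : Set Plane} (v : Lp ℝ 2 (volume.restrict D))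
    {φ : Plane → ℝ} (hφ : ContDiff ℝ ∞ φ) (hc : HasCompactSupport φ) :
    Integrable (fun x => v x • gradient φ x) (volume.restrict D) := by
  have h2 : MemLp (gradient φ) 2 (volume.restrict D) :=
    ((continuous_gradient hφ).memLp_of_hasCompactSupport
      (hasCompactSupport_gradient hc)).restrict D
  exact memLp_one_iff_integrable.1 (h2.smul (Lp.memLp v) (r := 1))

theorem integrable_smul_field {D : Set Plane} (g : Lp Plane 2 (volume.restrict D))
    {φ : Plane → ℝ} (hφ : ContDiff ℝ ∞ φ) (hc : HasCompactSupport φ) :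
    Integrable (fun x => φ x • g x) (volume.restrict D) := by
  have h2 : MemLp φ 2 (volume.restrict D) :=
    (hφ.continuous.memLp_of_hasCompactSupport hc).restrict D
  exact memLp_one_iff_integrable.1 ((Lp.memLp g).smul h2 (r := 1))

/-- The Sobolev space `H¹(D)`, as the space of pairs `(v, ∇v)` of an `L²` function and its weak
gradient in `L²`, with the norm `(‖v‖² + ‖∇v‖²)^{1/2}`. -/
def H1 (D : Set Plane) :
    Submodule ℝ (WithLp 2 (Lp ℝ 2 (volume.restrict D) × Lp Plane 2 (volume.restrict D))) where
  carrier := {p | IsWeakGradient D p.fst p.snd}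
  zero_mem' := by
    intro φ hφ hc hs
    have h1 : ∫ x in D, (0 : Lp ℝ 2 (volume.restrict D)) x • gradient φ x = 0 := by
      refine integral_eq_zero_of_ae ?_
      filter_upwards [Lp.coeFn_zero ℝ 2 (volume.restrict D)] with x hx
      rw [hx]
      simp
    have h2 : ∫ x in D, φ x • (0 : Lp Plane 2 (volume.restrict D)) x = 0 := by
      refine integral_eq_zero_of_ae ?_
      filter_upwards [Lp.coeFn_zero Plane 2 (volume.restrict D)] with x hx
      rw [hx]
      simp
    exact h1.trans ((neg_eq_zero.2 h2).symm)
  add_mem' := by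
    intro p q hp hq φ hφ hc hs
    have h1 : ∫ x in D, (p.fst + q.fst : Lp ℝ 2 (volume.restrict D)) x • gradient φ x
        = (∫ x in D, p.fst x • gradient φ x) + ∫ x in D, q.fst x • gradient φ x := by
      rw [← integral_add (integrable_smul_gradient _ hφ hc) (integrable_smul_gradient _ hφ hc)]
      refine integral_congr_ae ?_
      filter_upwards [Lp.coeFn_add p.fst q.fst] with x hx
      rw [hx, Pi.add_apply, add_smul]
    have h2 : ∫ x in D, φ x • (p.snd + q.snd : Lp Plane 2 (volume.restrict D)) x
        = (∫ x in D, φ x • p.snd x) + ∫ x in D, φ x • q.snd x := by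
      rw [← integral_add (integrable_smul_field _ hφ hc) (integrable_smul_field _ hφ hc)]
      refine integral_congr_ae ?_
      filter_upwards [Lp.coeFn_add p.snd q.snd] with x hx
      rw [hx, Pi.add_apply, smul_add]
    refine h1.trans ?_
    rw [hp φ hφ hc hs, hq φ hφ hc hs, ← neg_add, ← h2]
    rfl
  smul_mem' := by
    intro c p hp φ hφ hc hs
    have h1 : ∫ x in D, (c • p.fst : Lp ℝ 2 (volume.restrict D)) x • gradient φ x
        = c • ∫ x in D, p.fst x • gradient φ x := by
      rw [← integral_smul]
      refine integral_congr_ae ?_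
      filter_upwards [Lp.coeFn_smul c p.fst] with x hx
      rw [hx, Pi.smul_apply, smul_assoc]
    have h2 : ∫ x in D, φ x • (c • p.snd : Lp Plane 2 (volume.restrict D)) x
        = c • ∫ x in D, φ x • p.snd x := by
      rw [← integral_smul]
      refine integral_congr_ae ?_
      filter_upwards [Lp.coeFn_smul c p.snd] with x hx
      simp only [hx, Pi.smul_apply]
      rw [smul_comm]
    refine h1.trans ?_
    rw [hp φ hφ hc hs, smul_neg, ← h2]
    rfl

/-- The underlying `L²` function of an element of `H¹(D)`. -/
def fn {D : Set Plane} (v : H1 D) : Lp ℝ 2 (volume.restrict D) := v.1.fst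

/-- The weak gradient of an element of `H¹(D)`. -/
def grad {D : Set Plane} (v : H1 D) : Lp Plane 2 (volume.restrict D) := v.1.snd

/-! ### The trace operator and the Poincaré–Wirtinger constant -/

/-- `g ∈ L²(Γ)` is the trace on the curve of `v ∈ H¹(D)`, `D` the enclosed domain: there are smooth
functions converging to `v` in `H¹(D)` whose restrictions to the curve converge to `g`
in `L²(Γ)`. In other words `(v, g)` is in the closure of the graph of `φ ↦ φ|_Γ`. -/
def IsTrace (γ : ℝ → Plane) (L : ℝ) (v : H1 (enclosed γ L)) (g : Lp ℝ 2 (arcMeasure γ L)) :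
    Prop :=
  ∃ φ : ℕ → Plane → ℝ, (∀ n, ContDiff ℝ ∞ (φ n)) ∧
    Tendsto (fun n => eLpNorm (fun x => φ n x - fn v x) 2 (volume.restrict (enclosed γ L)))
      atTop (𝓝 0) ∧
    Tendsto (fun n => eLpNorm (fun x => gradient (φ n) x - grad v x) 2
      (volume.restrict (enclosed γ L))) atTop (𝓝 0) ∧
    Tendsto (fun n => eLpNorm (fun x => φ n x - g x) 2 (arcMeasure γ L)) atTop (𝓝 0)

open Classical in
/-- The trace operator `H¹(D) → L²(Γ)`. -/
def trace (γ : ℝ → Plane) (L : ℝ) (v : H1 (enclosed γ L)) : Lp ℝ 2 (arcMeasure γ L) :=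
  if h : ∃ g, IsTrace γ L v g then h.choose else 0

/-- The norm of the trace operator `H¹(D) → L²(Γ)`; it is `∞` unless every element of `H¹(D)` has
a trace and the traces are bounded (hence unique and linear in `v`). -/
def traceNorm (γ : ℝ → Plane) (L : ℝ) : ℝ≥0∞ :=
  sInf {C | ∀ v : H1 (enclosed γ L),
    (∃ g, IsTrace γ L v g) ∧ ∀ g, IsTrace γ L v g → ‖g‖ₑ ≤ C * ‖v‖ₑ}

/-- The Poincaré–Wirtinger constant of `D`: the smallest `C` with
`‖v - v̄‖_{H¹(D)} ≤ C ‖∇v‖_{L²(D)}` for all `v ∈ H¹(D)`, where `v̄` is the mean of `v` over `D`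
(both sides are squared here, and `∇(v - v̄) = ∇v`); it is `∞` if there is none. -/
def poincareConst (D : Set Plane) : ℝ≥0∞ :=
  sInf {C | ∀ v : H1 D,
    eLpNorm (fun x => fn v x - ⨍ x' in D, fn v x') 2 (volume.restrict D) ^ 2 + ‖grad v‖ₑ ^ 2
      ≤ (C * ‖grad v‖ₑ) ^ 2}

/-! ### The space `(H¹(D) ⊕ ℝ^M) / ℝ` -/

/-- `H¹(D) ⊕ ℝ^M` with the Hilbert space norm `(‖v‖²_{H¹} + |V|²)^{1/2}`. -/
abbrev PotentialPair (D : Set Plane) (M : ℕ) : Type := WithLp 2 (H1 D × EuclideanSpace ℝ (Fin M))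

/-- The line of the constant pairs `(c, c𝟏)`, `c ∈ ℝ`. -/
def constants (D : Set Plane) (M : ℕ) : Submodule ℝ (PotentialPair D M) where
  carrier := {p | ∃ c : ℝ, (∀ᵐ x ∂(volume.restrict D), fn p.fst x = c) ∧ grad p.fst = 0 ∧
    ∀ m, p.snd m = c}
  zero_mem' := ⟨0, Lp.coeFn_zero ℝ 2 (volume.restrict D), rfl, fun _ => rfl⟩
  add_mem' := by
    rintro p q ⟨c, h1, h2, h3⟩ ⟨d, k1, k2, k3⟩
    refine ⟨c + d, ?_, ?_, fun m => ?_⟩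
    · filter_upwards [h1, k1, Lp.coeFn_add (fn p.fst) (fn q.fst)] with x hx kx e
      refine Eq.trans e ?_
      simp [hx, kx]
    · change (grad p.fst) + (grad q.fst) = 0
      rw [h2, k2, add_zero]
    · change p.snd m + q.snd m = c + d
      rw [h3, k3]
  smul_mem' := by
    rintro a p ⟨c, h1, h2, h3⟩
    refine ⟨a * c, ?_, ?_, fun m => ?_⟩
    · filter_upwards [h1, Lp.coeFn_smul a (fn p.fst)] with x hx e
      refine Eq.trans e ?_
      simp [hx]
    · change a • grad p.fst = 0
      rw [h2, smul_zero]
    · change a * p.snd m = a * c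
      rw [h3]

/-- The space `(H¹(D) ⊕ ℝ^M) / ℝ` with the quotient norm
`‖(v, V)‖² = inf_c (‖v - c‖²_{H¹(D)} + |V - c𝟏|²)`. -/
abbrev QuotientSpace (D : Set Plane) (M : ℕ) : Type := PotentialPair D M ⧸ constants D M

/-- The class of `(v, V)` in `(H¹(D) ⊕ ℝ^M) / ℝ`. -/
def toQuotient {D : Set Plane} {M : ℕ} (v : H1 D) (V : EuclideanSpace ℝ (Fin M)) :
    QuotientSpace D M :=
  Submodule.Quotient.mk (WithLp.toLp 2 (v, V))

/-! ### The parametric complete electrode model -/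

/-- A point `y = (y_σ, y_γ, y_E, y_z)` of the hypercube `[-1/2, 1/2]^(N_σ + N_γ + 2M)`. -/
structure Parameter (Nσ Nγ M : ℕ) where
  /-- conductivity parameters -/
  cond : Cube Nσ
  /-- boundary curve parameters -/
  curve : Cube Nγ
  /-- electrode position parameters -/
  elec : Cube M
  /-- contact resistance parameters -/
  res : Cube M

/-- A parametrized measurement set-up of the complete electrode model. -/
structure Setup (Nσ Nγ M : ℕ) where
  two_le : 2 ≤ M
  /-- the period of the parametrizations of the boundary curves -/
  L : ℝ
  L_pos : 0 < L
  /-- the parametrized boundary curve -/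
  γ : Cube Nγ → ℝ → Plane
  jordan : ∀ y, IsLipschitzJordan (γ y) L
  /-- `y ↦ γ(·, y)` is continuous into the space `C^{0,1}` -/
  continuous_γ : ∀ y₀, ∀ ε : ℝ≥0, 0 < ε → ∀ᶠ y in 𝓝 y₀,
    (∀ t, ‖γ y t - γ y₀ t‖ ≤ ε) ∧ LipschitzWith ε (fun t => γ y t - γ y₀ t)
  /-- the bi-Lipschitz homeomorphism of the domain onto the reference domain -/
  Φ : Cube Nγ → Plane → Plane
  bijOn_Φ : ∀ y, BijOn (Φ y) (enclosed (γ y) L) (enclosed (γ (Cube.zero Nγ)) L)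
  bilipschitz_Φ : ∀ y, ∃ K : ℝ, ∀ x ∈ enclosed (γ y) L, ∀ x' ∈ enclosed (γ y) L,
    dist (Φ y x) (Φ y x') ≤ K * dist x x' ∧ dist x x' ≤ K * dist (Φ y x) (Φ y x')
  /-- the common width of the electrodes -/
  width : ℝ
  width_pos : 0 < width
  /-- the curve parameters of the starting points of the electrodes -/
  θ : Cube M → Fin M → ℝ
  θ_mem : ∀ y m, θ y m ∈ Ico 0 L
  continuous_θ : ∀ m, Continuous fun y => (θ y m : AddCircle L)
  no_overlap : ∀ j k, j ≠ k → ∀ yE yγ, width < arcDist (γ yγ) L_pos (θ yE j) (θ yE k)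
  /-- the parametrized conductivity in the reference domain -/
  σ₀ : Cube Nσ → Lp ℝ ⊤ (volume.restrict (enclosed (γ (Cube.zero Nγ)) L))
  continuous_σ₀ : Continuous σ₀
  σ₀_pos : ∀ y, ∃ c : ℝ, 0 < c ∧
    ∀ᵐ x ∂(volume.restrict (enclosed (γ (Cube.zero Nγ)) L)), c ≤ σ₀ y x
  /-- the parametrized contact resistances -/
  z : Cube M → Fin M → ℝ
  continuous_z : Continuous z
  z_pos : ∀ y m, 0 < z y m

namespace Setup

variable {Nσ Nγ M : ℕ} (P : Setup Nσ Nγ M)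

/-- The reference domain `D(0)`. -/
def refDomain : Set Plane := enclosed (P.γ (Cube.zero Nγ)) P.L

/-- The domain `D^y`. -/
def domain (y : Parameter Nσ Nγ M) : Set Plane := enclosed (P.γ y.curve) P.L

/-- The arc length measure on the boundary curve `Γ^y`. -/
def dS (y : Parameter Nσ Nγ M) : Measure Plane := arcMeasure (P.γ y.curve) P.L

/-- The electrode `E_m^y`. -/
def electrode (y : Parameter Nσ Nγ M) (m : Fin M) : Set Plane :=
  P.γ y.curve '' {t | t ∈ Ico 0 P.L ∧
    0 < arcDist (P.γ y.curve) P.L_pos (P.θ y.elec m) t ∧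
    arcDist (P.γ y.curve) P.L_pos (P.θ y.elec m) t < P.width}

/-- The conductivity `σ^y` in `D^y`. -/
def conductivity (y : Parameter Nσ Nγ M) (x : Plane) : ℝ := P.σ₀ y.cond (P.Φ y.curve x)

/-- `ς₋`, the minimum over `y_σ` of the essential infimum of `σ₀(·, y_σ)`. -/
def condMin : ℝ := ⨅ y : Cube Nσ, essInf (P.σ₀ y) (volume.restrict P.refDomain)

/-- `ς₊`, the maximum over `y_σ` of the `L^∞` norm of `σ₀(·, y_σ)`. -/
def condMax : ℝ := ⨆ y : Cube Nσ, ‖P.σ₀ y‖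

/-- `ζ₋`, the smallest contact resistance. -/
def resMin : ℝ := ⨅ m : Fin M, ⨅ y : Cube M, P.z y m

/-- `ζ₊`, the largest contact resistance. -/
def resMax : ℝ := ⨆ m : Fin M, ⨆ y : Cube M, P.z y m

/-- `C_tr`, the supremum over `y` of the norms of the trace operators `H¹(D^y) → L²(Γ^y)`. -/
def traceSup : ℝ≥0∞ := ⨆ y : Parameter Nσ Nγ M, traceNorm (P.γ y.curve) P.L

/-- `C_P`, the supremum over `y` of the Poincaré–Wirtinger constants of `D^y`. -/
def poincareSup : ℝ≥0∞ := ⨆ y : Parameter Nσ Nγ M, poincareConst (P.domain y)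

/-- The trace on `Γ^y` of a function in `H¹(D^y)`. -/
def tr (y : Parameter Nσ Nγ M) (v : H1 (P.domain y)) : Lp ℝ 2 (P.dS y) :=
  trace (P.γ y.curve) P.L v

/-- The variational form `B^y((w, W), (v, V))` of the complete electrode model, in terms of
representatives `(w, W), (v, V) ∈ H¹(D^y) ⊕ ℝ^M`. -/
def form (y : Parameter Nσ Nγ M) (w : H1 (P.domain y)) (W : EuclideanSpace ℝ (Fin M))
    (v : H1 (P.domain y)) (V : EuclideanSpace ℝ (Fin M)) : ℝ :=
  (∫ x in P.domain y, P.conductivity y x * inner ℝ (grad w x) (grad v x)) +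
    ∑ m : Fin M, 1 / P.z y.res m *
      ∫ x in P.electrode y m, (W m - P.tr y w x) * (V m - P.tr y v x) ∂(P.dS y)

end Setup

end CEM

end

/-! The form depends on a pair only through the weak gradient and the jumps `V_m - tr v`. Both are
linear and vanish on constant pairs, so both factor through the quotient, and the form is a sum of
weighted `L²` forms in them. This needs traces to be unique: the trace relation is linear, and
finiteness of `traceNorm` forces the only trace of `0` to be `0`. Hence the trace is linear, and the
trace of a constant is that constant (`IsTrace.eq_trace`, `isTrace_const`).

Upper bound: the form is symmetric and positive semidefinite, so by Cauchy–Schwarz its diagonal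
suffices. There `(V_m - t)² ≤ 2 V_m² + 2 t²` is integrated over the electrodes, which are disjoint
and have length exactly `ω`. The resulting bound by `‖v‖² + |V|²` holds for every representative,
hence for the infimum.

Lower bound: choose the representative with mean zero, so that `C_P` controls `‖v‖²` by the gradient
energy. Then `V_m² ≤ 2 (V_m - t)² + 2 t²`, integrated over the electrodes, controls `ω |V|²` by the
contact energy and the trace.

Three facts feed these estimates. In arc length coordinates an electrode is an interval modulo the
total length, which gives its measurability and length (`map_arcLength`, `speedMeasure_arcParams`).
The bi-Lipschitz map `Φ` pulls null sets back to null sets, so the bounds on `σ₀` carry over to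
`σ^y` (`ae_comp_of_bilipschitz`). Finally `ς₋ > 0` follows by compactness of the cube, once the
reference domain is known not to be null; the latter comes from the finite trace norm
(`volume_enclosed_ne_zero`), without the Jordan curve theorem. -/

noncomputable section

namespace CEM

/-! ### Arc length -/

/-- The length of the arc of `γ` from `γ 0` to `γ t`. -/
def arcLength (γ : ℝ → Plane) (t : ℝ) : ℝ := ∫ r in (0 : ℝ)..t, ‖deriv γ r‖

/-- The arc length measure on the parameter interval. -/
def speedMeasure (γ : ℝ → Plane) (L : ℝ) : Measure ℝ :=
  (volume.restrict (Ico 0 L)).withDensity (fun t => ‖deriv γ t‖ₑ)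

/-- The curve parameters of the arc of length `d` that starts at `γ s`. -/
def arcParams (γ : ℝ → Plane) {L : ℝ} (hL : 0 < L) (d s : ℝ) : Set ℝ :=
  {t | t ∈ Ico 0 L ∧ 0 < arcDist γ hL s t ∧ arcDist γ hL s t < d}

theorem IsLipschitzJordan.continuous {γ : ℝ → Plane} {L : ℝ} (h : IsLipschitzJordan γ L) :
    Continuous γ := by
  obtain ⟨K, hK⟩ := h.lipschitz
  exact hK.continuous

theorem IsLipschitzJordan.intervalIntegrable {γ : ℝ → Plane} {L : ℝ} (h : IsLipschitzJordan γ L)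
    (a b : ℝ) : IntervalIntegrable (fun r => ‖deriv γ r‖) volume a b := by
  obtain ⟨K, hK⟩ := h.lipschitz
  refine (intervalIntegrable_const (c := (K : ℝ))).mono_fun
    (measurable_deriv γ).norm.aestronglyMeasurable (ae_of_all _ fun t => ?_)
  simpa using norm_deriv_le_of_lipschitz hK

theorem IsLipschitzJordan.integral_speed {γ : ℝ → Plane} {L : ℝ} (h : IsLipschitzJordan γ L)
    (a b : ℝ) : ∫ r in a..b, ‖deriv γ r‖ = arcLength γ b - arcLength γ a :=
  (intervalIntegral.integral_interval_sub_left (h.intervalIntegrable _ _)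
    (h.intervalIntegrable _ _)).symm

theorem IsLipschitzJordan.arcLength_mono {γ : ℝ → Plane} {L : ℝ} (h : IsLipschitzJordan γ L) :
    Monotone (arcLength γ) := by
  intro a b hab
  have := intervalIntegral.integral_nonneg (μ := volume) hab fun r _ => norm_nonneg (deriv γ r)
  rw [h.integral_speed] at this
  linarith

theorem IsLipschitzJordan.continuous_arcLength {γ : ℝ → Plane} {L : ℝ}
    (h : IsLipschitzJordan γ L) : Continuous (arcLength γ) :=
  intervalIntegral.continuous_primitive h.intervalIntegrable 0

@[simp]
theorem arcLength_zero (γ : ℝ → Plane) : arcLength γ 0 = 0 := intervalIntegral.integral_same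

theorem IsLipschitzJordan.arcLength_add_period {γ : ℝ → Plane} {L : ℝ}
    (h : IsLipschitzJordan γ L) (t : ℝ) : arcLength γ (t + L) = arcLength γ t + arcLength γ L := by
  have hp : Function.Periodic (fun r => ‖deriv γ r‖) L := by
    intro r
    have : deriv γ (r + L) = deriv (fun x => γ (x + L)) r := (deriv_comp_add_const γ L r).symm
    simp only [this, h.periodic _]
  have := hp.intervalIntegral_add_eq t 0
  rw [h.integral_speed, h.integral_speed, zero_add, arcLength_zero] at this
  linarith

theorem IsLipschitzJordan.arcDist_of_le {γ : ℝ → Plane} {L : ℝ} (h : IsLipschitzJordan γ L)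
    (hL : 0 < L) {s t : ℝ} (hs : s ∈ Ico 0 L) (ht : t ∈ Ico 0 L) (hst : s ≤ t) :
    arcDist γ hL s t = arcLength γ t - arcLength γ s := by
  have : toIcoMod hL s t = t :=
    (toIcoMod_eq_iff hL).2 ⟨⟨hst, by linarith [hs.1, ht.2]⟩, 0, by simp⟩
  rw [arcDist, this, h.integral_speed]

theorem IsLipschitzJordan.arcDist_of_lt {γ : ℝ → Plane} {L : ℝ} (h : IsLipschitzJordan γ L)
    (hL : 0 < L) {s t : ℝ} (hs : s ∈ Ico 0 L) (ht : t ∈ Ico 0 L) (hst : t < s) :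
    arcDist γ hL s t = arcLength γ t + arcLength γ L - arcLength γ s := by
  have : toIcoMod hL s t = t + L :=
    (toIcoMod_eq_iff hL).2 ⟨⟨by linarith [hs.2, ht.1], by linarith⟩, -1, by simp⟩
  rw [arcDist, this, h.integral_speed, h.arcLength_add_period]

theorem IsLipschitzJordan.arcDist_le {γ : ℝ → Plane} {L : ℝ} (h : IsLipschitzJordan γ L)
    (hL : 0 < L) {s t : ℝ} (hs : s ∈ Ico 0 L) (ht : t ∈ Ico 0 L) :
    arcDist γ hL s t ≤ arcLength γ L := by
  have h0 : 0 ≤ arcLength γ s := by simpa using h.arcLength_mono hs.1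
  have h1 := h.arcLength_mono ht.2.le
  rcases le_or_gt s t with hst | hst
  · rw [h.arcDist_of_le hL hs ht hst]
    linarith
  · rw [h.arcDist_of_lt hL hs ht hst]
    linarith [h.arcLength_mono hst.le]

/-- Two arcs of length `d` whose starting points are more than `d` apart are disjoint. -/
theorem IsLipschitzJordan.disjoint_arcParams {γ : ℝ → Plane} {L : ℝ} (h : IsLipschitzJordan γ L)
    (hL : 0 < L) {d s s' : ℝ} (hs : s ∈ Ico 0 L) (hs' : s' ∈ Ico 0 L)
    (h1 : d < arcDist γ hL s s') (h2 : d < arcDist γ hL s' s) :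
    Disjoint (arcParams γ hL d s) (arcParams γ hL d s') := by
  rw [Set.disjoint_left]
  -- Going backwards from a common point `t`, both starting points are met within distance `d`, so
  -- one of them lies less than `d` before the other. The cases below run through the cyclic orders
  -- of `s`, `s'`, `t`; if `s = s'`, the hypothesis `h1` makes `d` negative.
  rintro t ⟨ht, p0, p1⟩ ⟨-, q0, q1⟩
  have m1 := @IsLipschitzJordan.arcLength_mono _ _ h s t
  have m2 := @IsLipschitzJordan.arcLength_mono _ _ h t s
  have m3 := @IsLipschitzJordan.arcLength_mono _ _ h s' t
  have m4 := @IsLipschitzJordan.arcLength_mono _ _ h t s'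
  have m5 := @IsLipschitzJordan.arcLength_mono _ _ h s s'
  have m6 := @IsLipschitzJordan.arcLength_mono _ _ h s' s
  have dle := @IsLipschitzJordan.arcDist_of_le _ _ h hL
  have dlt := @IsLipschitzJordan.arcDist_of_lt _ _ h hL
  rcases le_or_gt s s' with a | a
  · rw [dle hs hs' a] at h1
    rcases le_or_gt s t with b | b
    · rw [dle hs ht b] at p1
      rcases le_or_gt s' t with c | c
      · linarith [m3 c]
      · rw [dlt hs' ht c] at q1
        rcases a.eq_or_lt with rfl | a'
        · linarith
        · rw [dlt hs' hs a'] at h2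
          linarith [m1 b]
    · rw [dlt hs ht b] at p1
      rcases a.eq_or_lt with rfl | a'
      · linarith [m2 b.le, h.arcLength_mono hs.2.le, h.arcLength_mono hs.1,
          h.arcLength_mono ht.1, dlt hs ht b, dle hs hs' le_rfl]
      · rw [dlt hs' ht (b.trans a')] at q1
        rw [dlt hs' hs a'] at h2
        linarith [h.arcLength_mono hs'.2.le, h.arcLength_mono ht.1, arcLength_zero γ]
  · rw [dlt hs hs' a] at h1
    rw [dle hs' hs a.le] at h2
    rcases le_or_gt s' t with c | c
    · rw [dle hs' ht c] at q1
      rcases le_or_gt s t with b | b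
      · linarith [m1 b]
      · rw [dlt hs ht b] at p1
        linarith [m3 c]
    · rw [dlt hs' ht c] at q1
      rw [dlt hs ht (c.trans a)] at p1
      linarith [h.arcLength_mono hs.2.le, h.arcLength_mono ht.1, arcLength_zero γ]

/-! ### Electrode arcs in arc length coordinates -/

/-- The second interval is the part of the arc that wraps past the parameter `0`. Since `d` is less
than the total length, it ends before `arcLength γ s`, so parameters `t ≥ s` never fall into it.
Describing the arc as a preimage copes with a parametrization that stands still, where `arcLength`
is not injective. -/
theorem IsLipschitzJordan.arcParams_eq {γ : ℝ → Plane} {L : ℝ} (h : IsLipschitzJordan γ L)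
    (hL : 0 < L) {d s : ℝ} (hs : s ∈ Ico 0 L) (hd : d < arcLength γ L) :
    arcParams γ hL d s = Ico 0 L ∩ arcLength γ ⁻¹' (Ioo (arcLength γ s) (arcLength γ s + d) ∪
      Ioo (arcLength γ s - arcLength γ L) (arcLength γ s - arcLength γ L + d)) := by
  ext t
  simp only [arcParams, mem_ofPred_eq, mem_inter_iff, mem_preimage, mem_union, mem_Ioo]
  refine and_congr_right fun ht => ?_
  have h0 := h.arcLength_mono ht.1
  have h1 := h.arcLength_mono ht.2.le
  have h2 := h.arcLength_mono hs.1
  rcases le_or_gt s t with hst | hst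
  · have := h.arcLength_mono hst
    rw [h.arcDist_of_le hL hs ht hst]
    grind
  · have := h.arcLength_mono hst.le
    rw [h.arcDist_of_lt hL hs ht hst]
    grind

theorem IsLipschitzJordan.measurableSet_arcParams {γ : ℝ → Plane} {L : ℝ}
    (h : IsLipschitzJordan γ L) (hL : 0 < L) {d s : ℝ} (hs : s ∈ Ico 0 L)
    (hd : d < arcLength γ L) : MeasurableSet (arcParams γ hL d s) := by
  rw [h.arcParams_eq hL hs hd]
  exact measurableSet_Ico.inter
    (h.continuous_arcLength.measurable (measurableSet_Ioo.union measurableSet_Ioo))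

theorem IsLipschitzJordan.speedMeasure_Iic {γ : ℝ → Plane} {L : ℝ} (h : IsLipschitzJordan γ L)
    {t : ℝ} (ht : t ∈ Icc 0 L) : speedMeasure γ L (Iic t) = ENNReal.ofReal (arcLength γ t) := by
  rw [speedMeasure, withDensity_apply _ measurableSet_Iic, Measure.restrict_restrict
    measurableSet_Iic, arcLength, intervalIntegral.integral_of_le ht.1,
    integral_norm_eq_lintegral_enorm (measurable_deriv γ).aestronglyMeasurable,
    ENNReal.ofReal_toReal]
  · refine setLIntegral_congr ?_
    have h1 : (Ioc 0 t : Set ℝ) =ᵐ[volume] Ico 0 t := Ioc_ae_eq_Icc.trans Ico_ae_eq_Icc.symm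
    refine EventuallyEq.trans ?_ h1.symm
    rcases ht.2.eq_or_lt with rfl | htL
    · rw [inter_eq_right.2 fun x hx => hx.2.le]
      exact EventuallyEq.rfl
    · have : Iic t ∩ Ico 0 L = Icc 0 t := by
        ext x
        simp only [mem_inter_iff, mem_Iic, mem_Ico, mem_Icc]
        grind
      rw [this]
      exact Ico_ae_eq_Icc.symm
  · have := ((intervalIntegrable_iff_integrableOn_Ioc_of_le ht.1).1
      (h.intervalIntegrable 0 t)).hasFiniteIntegral
    simpa [HasFiniteIntegral] using this.ne

theorem IsLipschitzJordan.speedMeasure_univ {γ : ℝ → Plane} {L : ℝ} (h : IsLipschitzJordan γ L)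
    (hL : 0 ≤ L) : speedMeasure γ L univ = ENNReal.ofReal (arcLength γ L) := by
  rw [← h.speedMeasure_Iic ⟨hL, le_rfl⟩, speedMeasure, withDensity_apply _ MeasurableSet.univ,
    withDensity_apply _ measurableSet_Iic, Measure.restrict_restrict measurableSet_Iic,
    Measure.restrict_univ, inter_eq_right.2 fun x hx => hx.2.le]

/-- The arc length parameter is uniformly distributed. -/
theorem IsLipschitzJordan.map_arcLength {γ : ℝ → Plane} {L : ℝ} (h : IsLipschitzJordan γ L)
    (hL : 0 < L) :
    (speedMeasure γ L).map (arcLength γ) = volume.restrict (Ioc 0 (arcLength γ L)) := by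
  have hfin : IsFiniteMeasure ((speedMeasure γ L).map (arcLength γ)) := by
    have : IsFiniteMeasure (speedMeasure γ L) := ⟨by
      rw [h.speedMeasure_univ hL.le]
      exact ENNReal.ofReal_lt_top⟩
    infer_instance
  refine Measure.ext_of_Iic _ _ fun u => ?_
  rw [Measure.map_apply h.continuous_arcLength.measurable measurableSet_Iic,
    Measure.restrict_apply measurableSet_Iic]
  have hnn : ∀ t ∈ Ico 0 L, 0 ≤ arcLength γ t := fun t ht => by
    simpa using h.arcLength_mono ht.1
  -- The measure lives on `Ico 0 L`, so only the traces of sets on it matter.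
  have hsupp : ∀ s s' : Set ℝ, s ∩ Ico 0 L = s' ∩ Ico 0 L → MeasurableSet s → MeasurableSet s' →
      speedMeasure γ L s = speedMeasure γ L s' := by
    intro s s' hss hs hs'
    rw [speedMeasure, withDensity_apply _ hs, withDensity_apply _ hs',
      Measure.restrict_restrict hs, Measure.restrict_restrict hs', hss]
  have hpre : MeasurableSet (arcLength γ ⁻¹' Iic u) :=
    h.continuous_arcLength.measurable measurableSet_Iic
  rcases lt_or_ge u 0 with hu | hu
  · have e : Iic u ∩ Ioc 0 (arcLength γ L) = ∅ := by
      ext x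
      simp only [mem_inter_iff, mem_Iic, mem_Ioc, mem_empty_iff_false, iff_false]
      grind
    rw [e, measure_empty, hsupp _ ∅ _ hpre MeasurableSet.empty, measure_empty]
    ext x
    simp only [mem_inter_iff, mem_preimage, mem_Iic, mem_empty_iff_false, false_and, iff_false]
    exact fun hx => absurd hx.1 (not_le.2 (hu.trans_le (hnn x hx.2)))
  -- Take `t` to be the last parameter with arc length at most `u`; being last, it lies at the end
  -- of any plateau, so the sublevel set is `Iic t` up to parameters outside `Ico 0 L`.
  · obtain ⟨t, ⟨ht, htu⟩, hmax⟩ := (isCompact_Icc.inter_right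
      ((isClosed_Iic (a := u)).preimage h.continuous_arcLength)).exists_isGreatest
      (⟨0, ⟨le_rfl, hL.le⟩, by simpa using hu⟩ : (Icc 0 L ∩ arcLength γ ⁻¹' Iic u).Nonempty)
    have htu' : arcLength γ t ≤ u := htu
    have hle := h.arcLength_mono ht.2
    have e1 : speedMeasure γ L (arcLength γ ⁻¹' Iic u) = speedMeasure γ L (Iic t) := by
      refine hsupp _ _ ?_ hpre measurableSet_Iic
      ext x
      simp only [mem_inter_iff, mem_preimage, mem_Iic]
      refine and_congr_left fun hx => ⟨fun hxu => hmax ⟨⟨hx.1, hx.2.le⟩, hxu⟩, fun hxt => ?_⟩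
      exact (h.arcLength_mono hxt).trans htu'
    -- Otherwise the intermediate value theorem yields a later parameter whose arc length is still
    -- at most `u`.
    have e2 : arcLength γ t = min u (arcLength γ L) := by
      refine le_antisymm (le_min htu' hle) (not_lt.1 fun hlt => ?_)
      obtain ⟨c, hc, hcu⟩ := intermediate_value_Icc ht.2 h.continuous_arcLength.continuousOn
        ⟨hlt.le, min_le_right u (arcLength γ L)⟩
      have : c ≤ t := hmax ⟨⟨ht.1.trans hc.1, hc.2⟩, by
        rw [mem_preimage, hcu]
        exact min_le_left u (arcLength γ L)⟩
      rw [le_antisymm this hc.1] at hcu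
      exact hlt.ne hcu
    have e3 : Iic u ∩ Ioc 0 (arcLength γ L) = Ioc 0 (min u (arcLength γ L)) := by
      ext x
      simp only [mem_inter_iff, mem_Iic, mem_Ioc, le_min_iff]
      tauto
    rw [e1, h.speedMeasure_Iic ht, e2, e3, Real.volume_Ioc, sub_zero]

/-- By `map_arcLength` this is the Lebesgue measure of the two intervals inside `(0, ℓ]`. If the arc
does not wrap, only the first one counts; if it does, the pieces have lengths `ℓ - a` and `a + d -
ℓ`, with sum `d`. -/
theorem IsLipschitzJordan.speedMeasure_arcParams {γ : ℝ → Plane} {L : ℝ}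
    (h : IsLipschitzJordan γ L) (hL : 0 < L) {d s : ℝ} (hs : s ∈ Ico 0 L) (hd0 : 0 ≤ d)
    (hd : d < arcLength γ L) : speedMeasure γ L (arcParams γ hL d s) = ENNReal.ofReal d := by
  have h1 := h.arcLength_mono hs.2.le
  have h2 : 0 ≤ arcLength γ s := by simpa using h.arcLength_mono hs.1
  set ℓ := arcLength γ L
  set a := arcLength γ s with ha
  have hU : MeasurableSet (Ioo a (a + d) ∪ Ioo (a - ℓ) (a - ℓ + d)) :=
    measurableSet_Ioo.union measurableSet_Ioo
  have hr : (speedMeasure γ L).restrict (Ico 0 L) = speedMeasure γ L := by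
    rw [speedMeasure, restrict_withDensity measurableSet_Ico, Measure.restrict_restrict
      measurableSet_Ico, inter_self]
  rw [h.arcParams_eq hL hs hd, inter_comm, ← Measure.restrict_apply
    (h.continuous_arcLength.measurable hU), hr,
    ← Measure.map_apply h.continuous_arcLength.measurable hU, h.map_arcLength hL,
    Measure.restrict_apply hU]
  rcases le_or_gt (a + d) ℓ with hle | hlt
  · have e : (Ioo a (a + d) ∪ Ioo (a - ℓ) (a - ℓ + d)) ∩ Ioc 0 ℓ = Ioo a (a + d) := by
      ext x
      simp only [mem_inter_iff, mem_union, mem_Ioo, mem_Ioc]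
      grind
    rw [e, Real.volume_Ioo, add_sub_cancel_left]
  · have e : (Ioo a (a + d) ∪ Ioo (a - ℓ) (a - ℓ + d)) ∩ Ioc 0 ℓ =
        Ioc a ℓ ∪ Ioo 0 (a - ℓ + d) := by
      ext x
      simp only [mem_inter_iff, mem_union, mem_Ioo, mem_Ioc]
      grind
    have hd : Disjoint (Ioc a ℓ) (Ioo 0 (a - ℓ + d)) := by
      rw [Set.disjoint_left]
      simp only [mem_Ioo, mem_Ioc]
      grind
    rw [e, measure_union hd measurableSet_Ioo, Real.volume_Ioc, Real.volume_Ioo,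
      ← ENNReal.ofReal_add (by linarith) (by linarith)]
    congr 1
    ring

/-- A continuous injective image of a Borel set is Borel (Lusin–Souslin), and injectivity on one
period means that pulling the image back adds no further parameters. -/
theorem IsLipschitzJordan.arcMeasure_image {γ : ℝ → Plane} {L : ℝ} (h : IsLipschitzJordan γ L)
    {A : Set ℝ} (hA : MeasurableSet A) (hAL : A ⊆ Ico 0 L) :
    MeasurableSet (γ '' A) ∧ arcMeasure γ L (γ '' A) = speedMeasure γ L A := by
  have hm : MeasurableSet (γ '' A) :=
    hA.image_of_continuousOn_injOn h.continuous.continuousOn (h.injOn.mono hAL)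
  refine ⟨hm, ?_⟩
  have hpre : MeasurableSet (γ ⁻¹' (γ '' A)) := h.continuous.measurable hm
  rw [arcMeasure, Measure.map_apply h.continuous.measurable hm, speedMeasure,
    withDensity_apply _ hpre, withDensity_apply _ hA, Measure.restrict_restrict hpre,
    Measure.restrict_restrict hA]
  congr 2
  ext x
  refine ⟨?_, fun hx => ⟨⟨x, hx.1, rfl⟩, hx.2⟩⟩
  rintro ⟨⟨x', hx', hxx⟩, hx⟩
  exact ⟨h.injOn (hAL hx') hx hxx ▸ hx', hx⟩

theorem IsLipschitzJordan.arcMeasure_univ {γ : ℝ → Plane} {L : ℝ} (h : IsLipschitzJordan γ L)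
    (hL : 0 ≤ L) : arcMeasure γ L univ = ENNReal.ofReal (arcLength γ L) := by
  rw [arcMeasure, Measure.map_apply h.continuous.measurable MeasurableSet.univ, preimage_univ]
  exact h.speedMeasure_univ hL

theorem IsLipschitzJordan.isFiniteMeasure_arcMeasure {γ : ℝ → Plane} {L : ℝ}
    (h : IsLipschitzJordan γ L) (hL : 0 ≤ L) : IsFiniteMeasure (arcMeasure γ L) :=
  ⟨by
    rw [h.arcMeasure_univ hL]
    exact ENNReal.ofReal_lt_top⟩

section

/-! ### The enclosed domain -/

theorem IsLipschitzJordan.isCompact_image {γ : ℝ → Plane} {L : ℝ} (h : IsLipschitzJordan γ L)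
    (hL : 0 < L) : IsCompact (image γ L) := by
  have : image γ L = γ '' Icc 0 L := by
    refine Subset.antisymm (image_mono Ico_subset_Icc_self) ?_
    rintro _ ⟨t, ht, rfl⟩
    rcases ht.2.eq_or_lt with rfl | htL
    · exact ⟨0, ⟨le_rfl, hL⟩, by simpa using (h.periodic 0).symm⟩
    · exact ⟨t, ⟨ht.1, htL⟩, rfl⟩
  rw [this]
  exact isCompact_Icc.image h.continuous

/-- Components of an open set in the plane are open, and all points of a component share the
boundedness condition. -/
theorem IsLipschitzJordan.isOpen_enclosed {γ : ℝ → Plane} {L : ℝ} (h : IsLipschitzJordan γ L)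
    (hL : 0 < L) : IsOpen (enclosed γ L) := by
  have ho : IsOpen (image γ L)ᶜ := (h.isCompact_image hL).isClosed.isOpen_compl
  rw [isOpen_iff_mem_nhds]
  rintro x ⟨hx, hb⟩
  filter_upwards [ho.connectedComponentIn.mem_nhds (mem_connectedComponentIn hx)] with y hy
  exact ⟨connectedComponentIn_subset _ _ hy, connectedComponentIn_eq hy ▸ hb⟩

/-- A point outside a ball around the origin that contains the curve can escape to infinity along
its ray, so its component is unbounded. -/
theorem IsLipschitzJordan.isBounded_enclosed {γ : ℝ → Plane} {L : ℝ} (h : IsLipschitzJordan γ L)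
    (hL : 0 < L) : Bornology.IsBounded (enclosed γ L) := by
  obtain ⟨R, hR⟩ := (h.isCompact_image hL).isBounded.exists_norm_le
  refine isBounded_iff_forall_norm_le.2 ⟨max R 0, ?_⟩
  rintro x ⟨hx, hb⟩
  by_contra! hlt
  have hx0 : 0 < ‖x‖ := (le_max_right _ _).trans_lt hlt
  have hray : (fun r : ℝ => r • x) '' Ici 1 ⊆ connectedComponentIn (image γ L)ᶜ x := by
    refine IsPreconnected.subset_connectedComponentIn ?_ ⟨1, self_mem_Ici, one_smul _ _⟩ ?_
    · exact isPreconnected_Ici.image _ (by fun_prop)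
    · rintro _ ⟨r, hr, rfl⟩ hmem
      have h1 := hR _ hmem
      rw [norm_smul, Real.norm_of_nonneg (zero_le_one.trans hr)] at h1
      have h2 : ‖x‖ ≤ r * ‖x‖ := le_mul_of_one_le_left hx0.le hr
      linarith [le_max_left R 0]
  obtain ⟨R', hR'⟩ := (hb.subset hray).exists_norm_le
  have hr : (1 : ℝ) ≤ max 1 ((R' + 1) / ‖x‖) := le_max_left _ _
  have h1 := hR' _ ⟨_, hr, rfl⟩
  rw [norm_smul, Real.norm_of_nonneg (zero_le_one.trans hr)] at h1
  have h2 := mul_le_mul_of_nonneg_right (le_max_right 1 ((R' + 1) / ‖x‖)) hx0.le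
  rw [div_mul_cancel₀ _ hx0.ne'] at h2
  linarith

theorem IsLipschitzJordan.isFiniteMeasure_enclosed {γ : ℝ → Plane} {L : ℝ}
    (h : IsLipschitzJordan γ L) (hL : 0 < L) :
    IsFiniteMeasure ((volume : Measure Plane).restrict (enclosed γ L)) :=
  ⟨by
    rw [Measure.restrict_apply_univ]
    exact (h.isBounded_enclosed hL).measure_lt_top⟩

/-! ### Elements of `H¹` -/

theorem gradient_add_eq {φ ψ : Plane → ℝ} (hφ : ContDiff ℝ ∞ φ) (hψ : ContDiff ℝ ∞ ψ)
    (x : Plane) : gradient (fun x => φ x + ψ x) x = gradient φ x + gradient ψ x := by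
  have h1 : DifferentiableAt ℝ φ x := (hφ.differentiable (by simp)).differentiableAt
  have h2 : DifferentiableAt ℝ ψ x := (hψ.differentiable (by simp)).differentiableAt
  simp only [gradient, fderiv_fun_add h1 h2, map_add]

theorem gradient_const_mul_eq {φ : Plane → ℝ} (hφ : ContDiff ℝ ∞ φ) (c : ℝ)
    (x : Plane) : gradient (fun x => c * φ x) x = c • gradient φ x := by
  have h1 : DifferentiableAt ℝ φ x := (hφ.differentiable (by simp)).differentiableAt
  simp only [gradient, fderiv_const_mul h1, map_smul]

/-- Integration by parts against the constant `1`, one direction `e` at a time. It gives constants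
the weak gradient `0`. -/
theorem integral_gradient_eq_zero {φ : Plane → ℝ} (hφ : ContDiff ℝ ∞ φ)
    (hc : HasCompactSupport φ) : ∫ x, gradient φ x = 0 := by
  have hi : Integrable (gradient φ) :=
    (continuous_gradient hφ).integrable_of_hasCompactSupport (hasCompactSupport_gradient hc)
  refine integral_eq_zero_of_forall_integral_inner_eq_zero ℝ _ hi fun e => ?_
  have hd : Integrable fun x => (fderiv ℝ φ x) e := by
    simpa only [← inner_gradient_left, real_inner_comm] using hi.const_inner e
  have := integral_smul_fderiv_eq_neg_fderiv_smul_of_integrable (μ := volume) (𝕜 := ℝ)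
    (f := fun _ : Plane => (1 : ℝ)) (g := φ) (v := e) (by simp) (by simpa using hd)
    (by simpa using hφ.continuous.integrable_of_hasCompactSupport hc)
    (fun x _ => differentiableAt_const _)
    (fun x _ => (hφ.differentiable (by simp)).differentiableAt)
  have he : ∀ x, inner ℝ e (gradient φ x) = (fderiv ℝ φ x) e := fun x => by
    rw [real_inner_comm, inner_gradient_left]
  simpa [he] using this

theorem setIntegral_gradient_eq_zero {D : Set Plane} {φ : Plane → ℝ} (hφ : ContDiff ℝ ∞ φ)
    (hc : HasCompactSupport φ) (hs : tsupport φ ⊆ D) : ∫ x in D, gradient φ x = 0 := by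
  rw [setIntegral_eq_integral_of_forall_compl_eq_zero, integral_gradient_eq_zero hφ hc]
  intro x hx
  have : fderiv ℝ φ x = 0 := by
    by_contra hne
    exact hx (hs (support_fderiv_subset ℝ hne))
  rw [gradient, this, map_zero]

/-- The constant function `c` as an element of `H¹(D)`. -/
def constH1 (D : Set Plane) [IsFiniteMeasure ((volume : Measure Plane).restrict D)] (c : ℝ) :
    H1 D :=
  ⟨WithLp.toLp 2 (Lp.const 2 (volume.restrict D) c, 0), by
    intro φ hφ hc hs
    have h1 : ∫ x in D, (Lp.const 2 (volume.restrict D) c) x • gradient φ x = 0 := by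
      rw [integral_congr_ae (g := fun x => c • gradient φ x), integral_smul,
        setIntegral_gradient_eq_zero hφ hc hs, smul_zero]
      filter_upwards [Lp.coeFn_const 2 (volume.restrict D) c] with x hx
      rw [hx]
      rfl
    have h2 : ∫ x in D, φ x • (0 : Lp Plane 2 (volume.restrict D)) x = 0 := by
      refine integral_eq_zero_of_ae ?_
      filter_upwards [Lp.coeFn_zero Plane 2 (volume.restrict D)] with x hx
      rw [hx]
      simp
    exact h1.trans ((neg_eq_zero.2 h2).symm)⟩

@[simp]
theorem fn_constH1 (D : Set Plane) [IsFiniteMeasure ((volume : Measure Plane).restrict D)]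
    (c : ℝ) : fn (constH1 D c) = Lp.const 2 (volume.restrict D) c := rfl

@[simp]
theorem grad_constH1 (D : Set Plane) [IsFiniteMeasure ((volume : Measure Plane).restrict D)]
    (c : ℝ) : grad (constH1 D c) = 0 := rfl

theorem fn_add {D : Set Plane} (v w : H1 D) : fn (v + w) = fn v + fn w := rfl
theorem fn_sub {D : Set Plane} (v w : H1 D) : fn (v - w) = fn v - fn w := rfl
theorem fn_smul {D : Set Plane} (c : ℝ) (v : H1 D) : fn (c • v) = c • fn v := rfl
theorem grad_add {D : Set Plane} (v w : H1 D) : grad (v + w) = grad v + grad w := rfl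
theorem grad_sub {D : Set Plane} (v w : H1 D) : grad (v - w) = grad v - grad w := rfl
theorem grad_smul {D : Set Plane} (c : ℝ) (v : H1 D) : grad (c • v) = c • grad v := rfl

theorem grad_sub_constH1 {D : Set Plane} [IsFiniteMeasure ((volume : Measure Plane).restrict D)]
    (v : H1 D) (c : ℝ) : grad (v - constH1 D c) = grad v := by
  rw [grad_sub, grad_constH1, sub_zero]

theorem norm_sq_H1 {D : Set Plane} (v : H1 D) : ‖v‖ ^ 2 = ‖fn v‖ ^ 2 + ‖grad v‖ ^ 2 :=
  WithLp.prod_norm_sq_eq_of_L2 v.1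

/-! ### Traces -/

theorem tendsto_eLpNorm_add {E : Type*} [NormedAddCommGroup E] {μ : Measure Plane}
    {f g h : ℕ → Plane → E} (hf : ∀ n, AEStronglyMeasurable (f n) μ)
    (hg : ∀ n, AEStronglyMeasurable (g n) μ) (hh : ∀ n, h n =ᵐ[μ] f n + g n)
    (tf : Tendsto (fun n => eLpNorm (f n) 2 μ) atTop (𝓝 0))
    (tg : Tendsto (fun n => eLpNorm (g n) 2 μ) atTop (𝓝 0)) :
    Tendsto (fun n => eLpNorm (h n) 2 μ) atTop (𝓝 0) := by
  refine tendsto_of_tendsto_of_tendsto_of_le_of_le tendsto_const_nhds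
    (by simpa using tf.add tg) (fun n => zero_le) fun n => ?_
  rw [eLpNorm_congr_ae (hh n)]
  exact eLpNorm_add_le (hf n) (hg n) (by norm_num)

theorem tendsto_eLpNorm_const_smul {E : Type*} [NormedAddCommGroup E] [NormedSpace ℝ E]
    {μ : Measure Plane} {f h : ℕ → Plane → E} (c : ℝ) (hh : ∀ n, h n =ᵐ[μ] c • f n)
    (tf : Tendsto (fun n => eLpNorm (f n) 2 μ) atTop (𝓝 0)) :
    Tendsto (fun n => eLpNorm (h n) 2 μ) atTop (𝓝 0) := by
  have := ENNReal.Tendsto.const_mul tf (a := ‖c‖ₑ) (Or.inr enorm_ne_top)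
  rw [mul_zero] at this
  refine this.congr fun n => ?_
  rw [eLpNorm_congr_ae (hh n), eLpNorm_const_smul]

variable {γ : ℝ → Plane} {L : ℝ}

theorem IsTrace.add {v w : H1 (enclosed γ L)} {g k : Lp ℝ 2 (arcMeasure γ L)}
    (hv : IsTrace γ L v g) (hw : IsTrace γ L w k) : IsTrace γ L (v + w) (g + k) := by
  obtain ⟨φ, hφ, a1, a2, a3⟩ := hv
  obtain ⟨ψ, hψ, b1, b2, b3⟩ := hw
  refine ⟨fun n x => φ n x + ψ n x, fun n => (hφ n).add (hψ n), ?_, ?_, ?_⟩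
  · refine tendsto_eLpNorm_add
      (fun n => (hφ n).continuous.aestronglyMeasurable.sub (Lp.aestronglyMeasurable _))
      (fun n => (hψ n).continuous.aestronglyMeasurable.sub (Lp.aestronglyMeasurable _))
      (fun n => ?_) a1 b1
    filter_upwards [Lp.coeFn_add (fn v) (fn w)] with x hx
    rw [fn_add, hx]
    simp only [Pi.add_apply, Pi.sub_apply]
    ring
  · refine tendsto_eLpNorm_add
      (fun n => (continuous_gradient (hφ n)).aestronglyMeasurable.sub (Lp.aestronglyMeasurable _))
      (fun n => (continuous_gradient (hψ n)).aestronglyMeasurable.sub (Lp.aestronglyMeasurable _))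
      (fun n => ?_) a2 b2
    filter_upwards [Lp.coeFn_add (grad v) (grad w)] with x hx
    rw [grad_add, hx, gradient_add_eq (hφ n) (hψ n)]
    simp only [Pi.add_apply, Pi.sub_apply]
    abel
  · refine tendsto_eLpNorm_add
      (fun n => (hφ n).continuous.aestronglyMeasurable.sub (Lp.aestronglyMeasurable _))
      (fun n => (hψ n).continuous.aestronglyMeasurable.sub (Lp.aestronglyMeasurable _))
      (fun n => ?_) a3 b3
    filter_upwards [Lp.coeFn_add g k] with x hx
    rw [hx]
    simp only [Pi.add_apply, Pi.sub_apply]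
    ring

theorem IsTrace.smul {v : H1 (enclosed γ L)} {g : Lp ℝ 2 (arcMeasure γ L)}
    (hv : IsTrace γ L v g) (c : ℝ) : IsTrace γ L (c • v) (c • g) := by
  obtain ⟨φ, hφ, a1, a2, a3⟩ := hv
  refine ⟨fun n x => c * φ n x, fun n => contDiff_const.mul (hφ n), ?_, ?_, ?_⟩
  · refine tendsto_eLpNorm_const_smul c (fun n => ?_) a1
    filter_upwards [Lp.coeFn_smul c (fn v)] with x hx
    rw [fn_smul, hx]
    simp only [Pi.smul_apply, smul_eq_mul]
    ring
  · refine tendsto_eLpNorm_const_smul c (fun n => ?_) a2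
    filter_upwards [Lp.coeFn_smul c (grad v)] with x hx
    rw [grad_smul, hx, gradient_const_mul_eq (hφ n)]
    simp only [Pi.smul_apply, smul_sub]
  · refine tendsto_eLpNorm_const_smul c (fun n => ?_) a3
    filter_upwards [Lp.coeFn_smul c g] with x hx
    rw [hx]
    simp only [Pi.smul_apply, smul_eq_mul]
    ring

/-- The trace of a constant function is constant. -/
theorem isTrace_const [IsFiniteMeasure (arcMeasure γ L)] {v : H1 (enclosed γ L)} {c : ℝ}
    (hv : ∀ᵐ x ∂(volume.restrict (enclosed γ L)), fn v x = c) (hg : grad v = 0) :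
    IsTrace γ L v (Lp.const 2 (arcMeasure γ L) c) := by
  refine ⟨fun _ _ => c, fun _ => contDiff_const, ?_, ?_, ?_⟩
  · refine tendsto_const_nhds.congr fun n => Eq.symm ?_
    rw [eLpNorm_congr_ae (g := 0), eLpNorm_zero]
    filter_upwards [hv] with x hx
    simp [hx]
  · refine tendsto_const_nhds.congr fun n => Eq.symm ?_
    rw [eLpNorm_congr_ae (g := 0), eLpNorm_zero]
    filter_upwards [Lp.coeFn_zero Plane 2 (volume.restrict (enclosed γ L))] with x hx
    rw [hg, hx, gradient_fun_const]
    simp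
  · refine tendsto_const_nhds.congr fun n => Eq.symm ?_
    rw [eLpNorm_congr_ae (g := 0), eLpNorm_zero]
    filter_upwards [Lp.coeFn_const 2 (arcMeasure γ L) c] with x hx
    rw [hx]
    simp

/-! ### Boundedness, uniqueness and linearity of traces -/

/-- Continuity carries an estimate from the admissible constants to their infimum, so `traceNorm`
and `poincareConst` are themselves admissible when finite. -/
theorem le_apply_sInf {S : Set ℝ≥0∞} (hS : S.Nonempty) {f : ℝ≥0∞ → ℝ≥0∞} (hf : Continuous f)
    {a : ℝ≥0∞} (h : ∀ C ∈ S, a ≤ f C) : a ≤ f (sInf S) := by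
  obtain ⟨u, -, hu, hmem⟩ := exists_seq_tendsto_sInf hS (OrderBot.bddBelow S)
  exact ge_of_tendsto' ((hf.tendsto _).comp hu) fun n => h _ (hmem n)

theorem nonempty_of_sInf_ne_top {S : Set ℝ≥0∞} (h : sInf S ≠ ⊤) : S.Nonempty := by
  by_contra hne
  exact h (by rw [not_nonempty_iff_eq_empty.1 hne, sInf_empty])

theorem exists_isTrace (h : traceNorm γ L ≠ ⊤) (v : H1 (enclosed γ L)) : ∃ g, IsTrace γ L v g := by
  obtain ⟨C, hC⟩ := nonempty_of_sInf_ne_top h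
  exact (hC v).1

theorem isTrace_trace (h : traceNorm γ L ≠ ⊤) (v : H1 (enclosed γ L)) :
    IsTrace γ L v (trace γ L v) := by
  rw [trace, dif_pos (exists_isTrace h v)]
  exact (exists_isTrace h v).choose_spec

theorem IsTrace.enorm_le (h : traceNorm γ L ≠ ⊤) {v : H1 (enclosed γ L)}
    {g : Lp ℝ 2 (arcMeasure γ L)} (hg : IsTrace γ L v g) : ‖g‖ₑ ≤ traceNorm γ L * ‖v‖ₑ :=
  le_apply_sInf (nonempty_of_sInf_ne_top h)
    (ENNReal.continuous_mul_const enorm_ne_top) fun _ hC => (hC v).2 g hg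

/-- The bound by a multiple of the norm of `0` leaves no room for another trace; by linearity of the
relation, this is uniqueness for every `v`. -/
theorem IsTrace.eq_zero (h : traceNorm γ L ≠ ⊤) {g : Lp ℝ 2 (arcMeasure γ L)}
    (hg : IsTrace γ L 0 g) : g = 0 := by
  have h1 := hg.enorm_le h
  have h2 : ‖(0 : H1 (enclosed γ L))‖ₑ = 0 := enorm_zero
  rw [h2, mul_zero] at h1
  exact enorm_eq_zero.1 (nonpos_iff_eq_zero.1 h1)

theorem IsTrace.eq_trace (h : traceNorm γ L ≠ ⊤) {v : H1 (enclosed γ L)}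
    {g : Lp ℝ 2 (arcMeasure γ L)} (hg : IsTrace γ L v g) : trace γ L v = g := by
  have h1 := (isTrace_trace h v).add (hg.smul (-1))
  have h2 : v + (-1 : ℝ) • v = 0 := by module
  have h3 : trace γ L v + (-1 : ℝ) • g = trace γ L v - g := by module
  rw [h2, h3] at h1
  exact sub_eq_zero.1 (h1.eq_zero h)

theorem trace_add (h : traceNorm γ L ≠ ⊤) (v w : H1 (enclosed γ L)) :
    trace γ L (v + w) = trace γ L v + trace γ L w :=
  ((isTrace_trace h v).add (isTrace_trace h w)).eq_trace h

theorem trace_smul (h : traceNorm γ L ≠ ⊤) (c : ℝ) (v : H1 (enclosed γ L)) :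
    trace γ L (c • v) = c • trace γ L v :=
  ((isTrace_trace h v).smul c).eq_trace h

theorem norm_trace_le (h : traceNorm γ L ≠ ⊤) (v : H1 (enclosed γ L)) :
    ‖trace γ L v‖ ≤ (traceNorm γ L).toReal * ‖v‖ := by
  have := ENNReal.toReal_mono (ENNReal.mul_ne_top h enorm_ne_top) ((isTrace_trace h v).enorm_le h)
  simpa using this

/-- If the trace operator of the enclosed domain is bounded, then the domain is not a null set:
otherwise every constant is a trace of `0`. -/
theorem IsLipschitzJordan.volume_enclosed_ne_zero (hJ : IsLipschitzJordan γ L) (hL : 0 < L)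
    (hpos : 0 < arcLength γ L) (h : traceNorm γ L ≠ ⊤) : volume (enclosed γ L) ≠ 0 := by
  intro h0
  have := hJ.isFiniteMeasure_arcMeasure hL.le
  have h1 : IsTrace γ L 0 (Lp.const 2 (arcMeasure γ L) 1) := by
    refine isTrace_const ?_ rfl
    have : ae ((volume : Measure Plane).restrict (enclosed γ L)) = ⊥ :=
      ae_eq_bot.2 (Measure.restrict_eq_zero.2 h0)
    rw [this]
    trivial
  have h2 := h1.eq_zero h
  have h3 := Lp.coeFn_const 2 (arcMeasure γ L) (1 : ℝ)
  rw [h2] at h3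
  have h4 : ∀ᵐ x ∂(arcMeasure γ L), False := by
    filter_upwards [h3, Lp.coeFn_zero ℝ 2 (arcMeasure γ L)] with x hx hx'
    rw [hx'] at hx
    simp at hx
  have h5 : arcMeasure γ L univ = 0 := by simpa [ae_iff] using h4
  rw [hJ.arcMeasure_univ hL.le, ENNReal.ofReal_eq_zero] at h5
  linarith

/-- The Poincaré–Wirtinger inequality. -/
theorem norm_sq_sub_mean_le {D : Set Plane} [IsFiniteMeasure ((volume : Measure Plane).restrict D)]
    (h : poincareConst D ≠ ⊤) (v : H1 D) :
    ‖v - constH1 D (⨍ x in D, fn v x)‖ ^ 2 ≤ ((poincareConst D).toReal * ‖grad v‖) ^ 2 := by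
  have h1 := le_apply_sInf (f := fun C => (C * ‖grad v‖ₑ) ^ 2) (nonempty_of_sInf_ne_top h)
    ((ENNReal.continuous_pow 2).comp (ENNReal.continuous_mul_const enorm_ne_top))
    fun C hC => hC v
  change _ ≤ (poincareConst D * _) ^ 2 at h1
  have h2 : eLpNorm (fun x => fn v x - ⨍ x' in D, fn v x') 2 (volume.restrict D)
      = ‖fn (v - constH1 D (⨍ x in D, fn v x))‖ₑ := by
    rw [Lp.enorm_def, fn_sub, fn_constH1]
    refine eLpNorm_congr_ae ?_
    filter_upwards [Lp.coeFn_sub (fn v) (Lp.const 2 (volume.restrict D) (⨍ x in D, fn v x)),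
      Lp.coeFn_const 2 (volume.restrict D) (⨍ x in D, fn v x)] with x hx hx'
    rw [hx, Pi.sub_apply, hx']
    rfl
  rw [h2] at h1
  have h3 := ENNReal.toReal_mono
    (ENNReal.pow_ne_top (ENNReal.mul_ne_top h enorm_ne_top)) h1
  rw [ENNReal.toReal_add (ENNReal.pow_ne_top enorm_ne_top) (ENNReal.pow_ne_top enorm_ne_top)] at h3
  rw [norm_sq_H1, grad_sub_constH1]
  simpa using h3

end

/-! ### Null sets under bi-Lipschitz maps -/

/-- A bi-Lipschitz bijection pulls back almost everywhere statements. -/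
theorem ae_comp_of_bilipschitz {D D' : Set Plane} (hD : MeasurableSet D) (hD' : MeasurableSet D')
    {f : Plane → Plane} (hf : MapsTo f D D') {K : ℝ}
    (hK : ∀ x ∈ D, ∀ x' ∈ D, dist x x' ≤ K * dist (f x) (f x')) {p : Plane → Prop}
    (hp : ∀ᵐ x ∂(volume.restrict D'), p x) : ∀ᵐ x ∂(volume.restrict D), p (f x) := by
  rw [ae_restrict_iff' hD, ae_iff]
  rw [ae_restrict_iff' hD', ae_iff] at hp
  set A : Set Plane := {x | ¬ (x ∈ D → p (f x))} with hA
  have hAD : ∀ x ∈ A, x ∈ D ∧ ¬ p (f x) := fun x hx => by simpa [hA] using hx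
  have hinj : InjOn f A := fun x hx x' hx' e => by
    have := hK x (hAD x hx).1 x' (hAD x' hx').1
    rw [e, dist_self, mul_zero] at this
    exact dist_le_zero.1 this
  have hlip : LipschitzOnWith K.toNNReal (Function.invFunOn f A) (f '' A) := by
    refine LipschitzOnWith.of_dist_le_mul ?_
    rintro _ ⟨x, hx, rfl⟩ _ ⟨x', hx', rfl⟩
    rw [hinj.leftInvOn_invFunOn hx, hinj.leftInvOn_invFunOn hx']
    exact (hK x (hAD x hx).1 x' (hAD x' hx').1).trans
      (mul_le_mul_of_nonneg_right (Real.le_coe_toNNReal K) dist_nonneg)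
  -- Two-dimensional Hausdorff measure has the same null sets as Lebesgue measure, and Lipschitz
  -- maps preserve its null sets. The inverse of `f` maps the null set `f '' A` onto the exceptional
  -- set `A`, whose measurability is not required.
  let μ : Measure Plane := Measure.hausdorffMeasure (Module.finrank ℝ Plane : ℝ)
  have h1 : μ (f '' A) = 0 := by
    refine Measure.absolutelyContinuous_isAddHaarMeasure μ volume (measure_mono_null ?_ hp)
    rintro _ ⟨x, hx, rfl⟩
    have := hAD x hx
    simpa [hf this.1] using this.2
  have h2 : μ A = 0 := by
    have h3 := hlip.hausdorffMeasure_image_le (d := (Module.finrank ℝ Plane : ℝ)) (by positivity)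
    rw [hinj.leftInvOn_invFunOn.image_image] at h3
    change μ A ≤ _ * μ (f '' A) at h3
    rw [h1, mul_zero] at h3
    exact nonpos_iff_eq_zero.1 h3
  exact Measure.absolutelyContinuous_isAddHaarMeasure volume μ h2

theorem ae_abs_le_norm_top {μ : Measure Plane} (f : Lp ℝ ⊤ μ) : ∀ᵐ x ∂μ, |f x| ≤ ‖f‖ := by
  filter_upwards [ae_le_eLpNormEssSup (f := f) (μ := μ)] with x hx
  rw [← eLpNorm_exponent_top, ← Lp.enorm_def, enorm_le_iff_norm_le] at hx
  exact hx

/-! ### The parametric set-up -/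

namespace Setup

variable {Nσ Nγ M : ℕ} (P : Setup Nσ Nγ M)

/-- With at least two electrodes, some distance along the curve exceeds the width, and no such
distance exceeds the total length. -/
theorem width_lt_arcLength (y : Cube Nγ) : P.width < arcLength (P.γ y) P.L := by
  have h2 := P.two_le
  let i : Fin M := ⟨0, by omega⟩
  let j : Fin M := ⟨1, by omega⟩
  have hij : i ≠ j := by simp [i, j]
  exact (P.no_overlap i j hij (Cube.zero M) y).trans_le
    ((P.jordan y).arcDist_le P.L_pos (P.θ_mem _ _) (P.θ_mem _ _))

theorem arcLength_pos (y : Cube Nγ) : 0 < arcLength (P.γ y) P.L :=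
  P.width_pos.trans (P.width_lt_arcLength y)

theorem electrode_eq (y : Parameter Nσ Nγ M) (m : Fin M) :
    P.electrode y m = P.γ y.curve '' arcParams (P.γ y.curve) P.L_pos P.width (P.θ y.elec m) := rfl

theorem measurableSet_electrode (y : Parameter Nσ Nγ M) (m : Fin M) :
    MeasurableSet (P.electrode y m) :=
  ((P.jordan y.curve).arcMeasure_image ((P.jordan y.curve).measurableSet_arcParams P.L_pos
    (P.θ_mem _ _) (P.width_lt_arcLength _)) fun _ ht => ht.1).1

theorem dS_electrode (y : Parameter Nσ Nγ M) (m : Fin M) :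
    P.dS y (P.electrode y m) = ENNReal.ofReal P.width :=
  ((P.jordan y.curve).arcMeasure_image ((P.jordan y.curve).measurableSet_arcParams P.L_pos
    (P.θ_mem _ _) (P.width_lt_arcLength _)) fun _ ht => ht.1).2.trans
    ((P.jordan y.curve).speedMeasure_arcParams P.L_pos (P.θ_mem _ _) P.width_pos.le
      (P.width_lt_arcLength _))

theorem pairwise_disjoint_electrode (y : Parameter Nσ Nγ M) :
    Pairwise (Function.onFun Disjoint (P.electrode y)) := by
  intro j k hjk
  have hd := (P.jordan y.curve).disjoint_arcParams P.L_pos (P.θ_mem y.elec j) (P.θ_mem y.elec k)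
    (P.no_overlap j k hjk _ _) (P.no_overlap k j hjk.symm _ _)
  rw [Function.onFun, electrode_eq, electrode_eq]
  rw [Set.disjoint_left]
  rintro _ ⟨s, hs, rfl⟩ ⟨t, ht, hst⟩
  exact Set.disjoint_left.1 hd hs ((P.jordan y.curve).injOn ht.1 hs.1 hst ▸ ht)

instance isFiniteMeasure_dS (y : Parameter Nσ Nγ M) : IsFiniteMeasure (P.dS y) :=
  (P.jordan y.curve).isFiniteMeasure_arcMeasure P.L_pos.le

instance isFiniteMeasure_domain (y : Parameter Nσ Nγ M) :
    IsFiniteMeasure ((volume : Measure Plane).restrict (P.domain y)) :=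
  (P.jordan y.curve).isFiniteMeasure_enclosed P.L_pos

theorem traceNorm_le (y : Parameter Nσ Nγ M) : traceNorm (P.γ y.curve) P.L ≤ P.traceSup :=
  le_iSup (fun y : Parameter Nσ Nγ M => traceNorm (P.γ y.curve) P.L) y

theorem poincareConst_le (y : Parameter Nσ Nγ M) : poincareConst (P.domain y) ≤ P.poincareSup :=
  le_iSup (fun y : Parameter Nσ Nγ M => poincareConst (P.domain y)) y

/-! ### Conductivities -/

/-- A lower bound `c` at `y₀` gives `c / 2` on an `L^∞` ball around `σ₀ y₀`. Compactness of the cube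
leaves finitely many such constants to compare. -/
theorem exists_uniform_lower_bound : ∃ c : ℝ, 0 < c ∧
    ∀ y, ∀ᵐ x ∂(volume.restrict P.refDomain), c ≤ P.σ₀ y x := by
  suffices h : ∃ c : ℝ, 0 < c ∧ ∀ y ∈ (univ : Set (Cube Nσ)),
      ∀ᵐ x ∂(volume.restrict P.refDomain), c ≤ P.σ₀ y x by simpa using h
  refine isCompact_univ.induction_on (p := fun s => ∃ c : ℝ, 0 < c ∧ ∀ y ∈ s,
      ∀ᵐ x ∂(volume.restrict P.refDomain), c ≤ P.σ₀ y x) ⟨1, one_pos, by simp⟩ ?_ ?_ ?_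
  · rintro s t hst ⟨c, hc, h⟩
    exact ⟨c, hc, fun y hy => h y (hst hy)⟩
  · rintro s t ⟨c, hc, h⟩ ⟨d, hd, k⟩
    refine ⟨min c d, lt_min hc hd, ?_⟩
    rintro y (hy | hy)
    · filter_upwards [h y hy] with x hx using (min_le_left _ _).trans hx
    · filter_upwards [k y hy] with x hx using (min_le_right _ _).trans hx
  · intro y₀ _
    obtain ⟨c, hc, h⟩ := P.σ₀_pos y₀
    refine ⟨P.σ₀ ⁻¹' Metric.ball (P.σ₀ y₀) (c / 2), ?_, c / 2, half_pos hc, fun y hy => ?_⟩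
    · rw [nhdsWithin_univ]
      exact P.continuous_σ₀.continuousAt.preimage_mem_nhds (Metric.ball_mem_nhds _ (half_pos hc))
    · rw [mem_preimage, mem_ball_iff_norm] at hy
      have h1 : ∀ᵐ x ∂(volume.restrict P.refDomain), c ≤ P.σ₀ y₀ x := h
      have h2 : ∀ᵐ x ∂(volume.restrict P.refDomain), |(P.σ₀ y - P.σ₀ y₀) x| ≤ ‖P.σ₀ y - P.σ₀ y₀‖ :=
        ae_abs_le_norm_top _
      have h3 : ∀ᵐ x ∂(volume.restrict P.refDomain),
        (P.σ₀ y - P.σ₀ y₀) x = P.σ₀ y x - P.σ₀ y₀ x := Lp.coeFn_sub _ _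
      filter_upwards [h1, h2, h3] with x a b e
      rw [e] at b
      linarith [(abs_le.1 b).1]

theorem volume_refDomain_ne_zero (h : P.traceSup ≠ ⊤) : volume P.refDomain ≠ 0 := by
  let y : Parameter Nσ Nγ M := ⟨Cube.zero _, Cube.zero _, Cube.zero _, Cube.zero _⟩
  exact (P.jordan (Cube.zero Nγ)).volume_enclosed_ne_zero P.L_pos (P.arcLength_pos _)
    (ne_top_of_le_ne_top h (P.traceNorm_le y))

/-- On a null domain every real number would be an essential lower bound and the real-valued
`essInf` would carry no information, hence the appeal to the finite trace norm. -/
theorem le_essInf_conductivity (h : P.traceSup ≠ ⊤) {c : ℝ} {y : Cube Nσ}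
    (hc : ∀ᵐ x ∂(volume.restrict P.refDomain), c ≤ P.σ₀ y x) :
    c ≤ essInf (P.σ₀ y) (volume.restrict P.refDomain) := by
  have : (ae ((volume : Measure Plane).restrict P.refDomain)).NeBot :=
    ae_neBot.2 (Measure.restrict_eq_zero.not.2 (P.volume_refDomain_ne_zero h))
  refine le_essInf_of_ae_le c hc ?_
  refine IsBoundedUnder.isCoboundedUnder_ge ⟨‖P.σ₀ y‖, ?_⟩
  have h2 : ∀ᵐ x ∂(volume.restrict P.refDomain), |P.σ₀ y x| ≤ ‖P.σ₀ y‖ := ae_abs_le_norm_top _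
  rw [eventually_map]
  filter_upwards [h2] with x hx using (le_abs_self _).trans hx

theorem condMin_pos (h : P.traceSup ≠ ⊤) : 0 < P.condMin := by
  obtain ⟨c, hc, hle⟩ := P.exists_uniform_lower_bound
  have : Nonempty (Cube Nσ) := ⟨Cube.zero _⟩
  exact hc.trans_le (le_ciInf fun y => P.le_essInf_conductivity h (hle y))

theorem condMin_le (h : P.traceSup ≠ ⊤) (y : Cube Nσ) :
    ∀ᵐ x ∂(volume.restrict P.refDomain), P.condMin ≤ P.σ₀ y x := by
  obtain ⟨c, hc, hle⟩ := P.exists_uniform_lower_bound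
  have hb : BddBelow (range fun y => essInf (P.σ₀ y) (volume.restrict P.refDomain)) := by
    refine ⟨c, ?_⟩
    rintro _ ⟨y, rfl⟩
    exact P.le_essInf_conductivity h (hle y)
  have h1 : ∀ᵐ x ∂(volume.restrict P.refDomain),
      essInf (P.σ₀ y) (volume.restrict P.refDomain) ≤ P.σ₀ y x :=
    ae_essInf_le (isBoundedUnder_of_eventually_ge (hle y))
  filter_upwards [h1] with x hx using (ciInf_le hb y).trans hx

theorem abs_le_condMax (y : Cube Nσ) :
    ∀ᵐ x ∂(volume.restrict P.refDomain), |P.σ₀ y x| ≤ P.condMax := by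
  have hb : BddAbove (range fun y => ‖P.σ₀ y‖) :=
    (isCompact_range P.continuous_σ₀.norm).bddAbove
  have h2 : ∀ᵐ x ∂(volume.restrict P.refDomain), |P.σ₀ y x| ≤ ‖P.σ₀ y‖ := ae_abs_le_norm_top _
  filter_upwards [h2] with x hx using hx.trans (le_ciSup hb y)

theorem condMax_nonneg : 0 ≤ P.condMax := Real.iSup_nonneg fun _ => norm_nonneg _

theorem measurableSet_domain (y : Parameter Nσ Nγ M) : MeasurableSet (P.domain y) :=
  ((P.jordan _).isOpen_enclosed P.L_pos).measurableSet

/-- The values of `σ^y` are those of `σ₀` read through `Φ`, and exceptional null sets pull back to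
null sets. -/
theorem ae_conductivity {p : ℝ → Prop} (y : Parameter Nσ Nγ M)
    (h : ∀ᵐ x ∂(volume.restrict P.refDomain), p (P.σ₀ y.cond x)) :
    ∀ᵐ x ∂(volume.restrict (P.domain y)), p (P.conductivity y x) := by
  obtain ⟨K, hK⟩ := P.bilipschitz_Φ y.curve
  exact ae_comp_of_bilipschitz (p := fun x => p (P.σ₀ y.cond x)) (P.measurableSet_domain y)
    ((P.jordan _).isOpen_enclosed P.L_pos).measurableSet (P.bijOn_Φ y.curve).mapsTo
    (fun x hx x' hx' => (hK x hx x' hx').2) h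

theorem aestronglyMeasurable_conductivity (y : Parameter Nσ Nγ M) :
    AEStronglyMeasurable (P.conductivity y) (volume.restrict (P.domain y)) := by
  obtain ⟨K, hK⟩ := P.bilipschitz_Φ y.curve
  have hlip : LipschitzOnWith K.toNNReal (P.Φ y.curve) (P.domain y) :=
    LipschitzOnWith.of_dist_le_mul fun x hx x' hx' => (hK x hx x' hx').1.trans
      (mul_le_mul_of_nonneg_right (Real.le_coe_toNNReal K) dist_nonneg)
  have := (Lp.stronglyMeasurable (P.σ₀ y.cond)).measurable.comp_aemeasurable
    (hlip.continuousOn.aemeasurable (μ := volume) (P.measurableSet_domain y))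
  exact this.aestronglyMeasurable

/-! ### Contact resistances -/

theorem continuous_res (m : Fin M) : Continuous fun y => P.z y m :=
  (continuous_apply m).comp P.continuous_z

theorem resMin_le (y : Cube M) (m : Fin M) : P.resMin ≤ P.z y m :=
  (ciInf_le (finite_range _).bddBelow m).trans
    (ciInf_le (isCompact_range (P.continuous_res m)).bddBelow y)

theorem le_resMax (y : Cube M) (m : Fin M) : P.z y m ≤ P.resMax :=
  (le_ciSup (isCompact_range (P.continuous_res m)).bddAbove y).trans
    (le_ciSup (f := fun m => ⨆ y : Cube M, P.z y m) (finite_range _).bddAbove m)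

/-- Finitely many electrodes and a compact cube: the infimum is attained at a positive value. -/
theorem resMin_pos : 0 < P.resMin := by
  have : Nonempty (Cube M) := ⟨Cube.zero _⟩
  have : Nonempty (Fin M) := ⟨⟨0, by have := P.two_le; omega⟩⟩
  obtain ⟨m, hm⟩ := exists_eq_ciInf_of_finite (f := fun m : Fin M => ⨅ y : Cube M, P.z y m)
  obtain ⟨y, hy⟩ := (isCompact_range (P.continuous_res m)).sInf_mem (range_nonempty _)
  rw [resMin, ← hm]
  change 0 < sInf (range fun y => P.z y m)
  rw [← hy]
  exact P.z_pos y m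

theorem resMax_pos : 0 < P.resMax := by
  have h2 := P.two_le
  exact (P.z_pos (Cube.zero M) ⟨0, by omega⟩).trans_le (P.le_resMax _ _)

end Setup

/-! ### Weighted `L²` forms -/

theorem integrable_weighted_inner {α F : Type*} [MeasurableSpace α] [NormedAddCommGroup F]
    [InnerProductSpace ℝ F] {μ : Measure α} {s : α → ℝ} (hs : AEStronglyMeasurable s μ) {C : ℝ}
    (hC : ∀ᵐ x ∂μ, |s x| ≤ C) (f g : Lp F 2 μ) :
    Integrable (fun x => s x * inner ℝ (f x) (g x)) μ :=
  (L2.integrable_inner f g).bdd_mul hs hC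

/-- The bilinear form `(f, g) ↦ ∫ s ⟨f, g⟩ dμ` on `L²` with a bounded weight `s`. -/
def weightedForm {α F : Type*} [MeasurableSpace α] [NormedAddCommGroup F]
    [InnerProductSpace ℝ F] {μ : Measure α} {s : α → ℝ} (hs : AEStronglyMeasurable s μ) {C : ℝ}
    (hC : ∀ᵐ x ∂μ, |s x| ≤ C) : Lp F 2 μ →ₗ[ℝ] Lp F 2 μ →ₗ[ℝ] ℝ :=
  LinearMap.mk₂ ℝ (fun f g => ∫ x, s x * inner ℝ (f x) (g x) ∂μ)
    (fun f f' g => by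
      rw [← integral_add (integrable_weighted_inner hs hC f g)
        (integrable_weighted_inner hs hC f' g)]
      refine integral_congr_ae ?_
      filter_upwards [Lp.coeFn_add f f'] with x hx
      rw [hx, Pi.add_apply, inner_add_left, mul_add])
    (fun c f g => by
      rw [← integral_smul]
      refine integral_congr_ae ?_
      filter_upwards [Lp.coeFn_smul c f] with x hx
      rw [hx, Pi.smul_apply, real_inner_smul_left, smul_eq_mul]
      ring)
    (fun f g g' => by
      rw [← integral_add (integrable_weighted_inner hs hC f g)
        (integrable_weighted_inner hs hC f g')]
      refine integral_congr_ae ?_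
      filter_upwards [Lp.coeFn_add g g'] with x hx
      rw [hx, Pi.add_apply, inner_add_right, mul_add])
    (fun c f g => by
      rw [← integral_smul]
      refine integral_congr_ae ?_
      filter_upwards [Lp.coeFn_smul c g] with x hx
      rw [hx, Pi.smul_apply, real_inner_smul_right, smul_eq_mul]
      ring)

theorem weightedForm_apply {α F : Type*} [MeasurableSpace α] [NormedAddCommGroup F]
    [InnerProductSpace ℝ F] {μ : Measure α} {s : α → ℝ} (hs : AEStronglyMeasurable s μ) {C : ℝ}
    (hC : ∀ᵐ x ∂μ, |s x| ≤ C) (f g : Lp F 2 μ) :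
    weightedForm hs hC f g = ∫ x, s x * inner ℝ (f x) (g x) ∂μ := rfl

theorem norm_sq_Lp {α F : Type*} [MeasurableSpace α] [NormedAddCommGroup F]
    [InnerProductSpace ℝ F] {μ : Measure α} (f : Lp F 2 μ) :
    ‖f‖ ^ 2 = ∫ x, inner ℝ (f x) (f x) ∂μ := by
  rw [← real_inner_self_eq_norm_sq, L2.inner_def]

theorem mul_norm_sq_le_integral {α F : Type*} [MeasurableSpace α] [NormedAddCommGroup F]
    [InnerProductSpace ℝ F] {μ : Measure α} {s : α → ℝ} (hs : AEStronglyMeasurable s μ) {C c : ℝ}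
    (hC : ∀ᵐ x ∂μ, |s x| ≤ C) (hc : ∀ᵐ x ∂μ, c ≤ s x) (f : Lp F 2 μ) :
    c * ‖f‖ ^ 2 ≤ ∫ x, s x * inner ℝ (f x) (f x) ∂μ := by
  rw [norm_sq_Lp, ← integral_const_mul]
  refine integral_mono_ae ((L2.integrable_inner f f).const_mul c)
    (integrable_weighted_inner hs hC f f) ?_
  filter_upwards [hc] with x hx
  exact mul_le_mul_of_nonneg_right hx real_inner_self_nonneg

theorem integral_le_mul_norm_sq {α F : Type*} [MeasurableSpace α] [NormedAddCommGroup F]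
    [InnerProductSpace ℝ F] {μ : Measure α} {s : α → ℝ} (hs : AEStronglyMeasurable s μ) {C : ℝ}
    (hC : ∀ᵐ x ∂μ, |s x| ≤ C) (f : Lp F 2 μ) :
    ∫ x, s x * inner ℝ (f x) (f x) ∂μ ≤ C * ‖f‖ ^ 2 := by
  rw [norm_sq_Lp, ← integral_const_mul]
  refine integral_mono_ae (integrable_weighted_inner hs hC f f)
    ((L2.integrable_inner f f).const_mul C) ?_
  filter_upwards [hC] with x hx
  exact mul_le_mul_of_nonneg_right ((le_abs_self _).trans hx) real_inner_self_nonneg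

/-! ### Voltages and traces on the electrodes -/

theorem integrable_mul_Lp {α : Type*} [MeasurableSpace α] {μ : Measure α} (f g : Lp ℝ 2 μ) :
    Integrable (fun x => f x * g x) μ := by
  simpa [mul_comm] using L2.integrable_inner (𝕜 := ℝ) f g

theorem integrable_const_sub_sq {α : Type*} [MeasurableSpace α] {μ : Measure α}
    [IsFiniteMeasure μ] (c : ℝ) (t : Lp ℝ 2 μ) : Integrable (fun x => (c - t x) * (c - t x)) μ := by
  refine (integrable_mul_Lp (Lp.const 2 μ c - t) (Lp.const 2 μ c - t)).congr ?_
  filter_upwards [Lp.coeFn_sub (Lp.const 2 μ c) t, Lp.coeFn_const 2 μ c] with x hx hx'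
  rw [hx, Pi.sub_apply, hx']
  rfl

/-- Disjointness of the electrodes enters here: the traces on them are bounded together by one norm,
with no factor `M`. -/
theorem sum_setIntegral_sq_le {α ι : Type*} [Fintype ι] [MeasurableSpace α] {μ : Measure α}
    {E : ι → Set α} (hE : ∀ m, MeasurableSet (E m)) (hd : Pairwise (Function.onFun Disjoint E))
    (t : Lp ℝ 2 μ) : ∑ m, ∫ x in E m, t x * t x ∂μ ≤ ‖t‖ ^ 2 := by
  have hi := integrable_mul_Lp t t
  rw [← integral_iUnion_fintype hE hd fun m => hi.integrableOn, norm_sq_Lp]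
  exact setIntegral_le_integral hi (ae_of_all _ fun x => mul_self_nonneg _)

theorem sum_electrode_le {α ι : Type*} [Fintype ι] [MeasurableSpace α] {μ : Measure α}
    [IsFiniteMeasure μ] {E : ι → Set α} (hE : ∀ m, MeasurableSet (E m))
    (hd : Pairwise (Function.onFun Disjoint E)) {d : ℝ} (hμ : ∀ m, μ.real (E m) = d)
    (t : Lp ℝ 2 μ) (V : EuclideanSpace ℝ ι) :
    ∑ m, ∫ x in E m, (V m - t x) * (V m - t x) ∂μ ≤ 2 * d * ‖V‖ ^ 2 + 2 * ‖t‖ ^ 2 := by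
  have h1 : ∀ m, ∫ x in E m, (V m - t x) * (V m - t x) ∂μ ≤
      2 * d * V m ^ 2 + 2 * ∫ x in E m, t x * t x ∂μ := by
    intro m
    have hc : ∫ x in E m, 2 * V m ^ 2 ∂μ = 2 * d * V m ^ 2 := by
      rw [setIntegral_const, hμ, smul_eq_mul]
      ring
    rw [← hc, ← integral_const_mul, ← integral_add (integrable_const _)
      ((integrable_mul_Lp t t).integrableOn.const_mul 2)]
    refine integral_mono (integrable_const_sub_sq _ _).integrableOn
      ((integrable_const _).add ((integrable_mul_Lp t t).integrableOn.const_mul 2)) fun x => ?_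
    change (V m - t x) * (V m - t x) ≤ 2 * V m ^ 2 + 2 * (t x * t x)
    -- The difference of the two sides is `(V m + t x)²`.
    nlinarith [sq_nonneg (V m + t x)]
  refine (Finset.sum_le_sum fun m _ => h1 m).trans ?_
  rw [Finset.sum_add_distrib, ← Finset.mul_sum, ← Finset.mul_sum, EuclideanSpace.real_norm_sq_eq]
  linarith [sum_setIntegral_sq_le hE hd t]

theorem voltage_norm_sq_le {α ι : Type*} [Fintype ι] [MeasurableSpace α] {μ : Measure α}
    [IsFiniteMeasure μ] {E : ι → Set α} (hE : ∀ m, MeasurableSet (E m))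
    (hd : Pairwise (Function.onFun Disjoint E)) {d : ℝ} (hμ : ∀ m, μ.real (E m) = d)
    (t : Lp ℝ 2 μ) (V : EuclideanSpace ℝ ι) :
    d * ‖V‖ ^ 2 ≤ 2 * ∑ m, ∫ x in E m, (V m - t x) * (V m - t x) ∂μ + 2 * ‖t‖ ^ 2 := by
  have h1 : ∀ m, d * V m ^ 2 ≤
      2 * ∫ x in E m, (V m - t x) * (V m - t x) ∂μ + 2 * ∫ x in E m, t x * t x ∂μ := by
    intro m
    have hc : ∫ x in E m, V m ^ 2 ∂μ = d * V m ^ 2 := by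
      rw [setIntegral_const, hμ, smul_eq_mul]
    have i1 := (integrable_const_sub_sq (V m) t).integrableOn (s := E m) |>.const_mul 2
    have i2 := (integrable_mul_Lp t t).integrableOn (s := E m) |>.const_mul 2
    rw [← hc, ← integral_const_mul, ← integral_const_mul, ← integral_add i1 i2]
    refine integral_mono (integrable_const _) (i1.add i2) fun x => ?_
    change V m ^ 2 ≤ 2 * ((V m - t x) * (V m - t x)) + 2 * (t x * t x)
    -- The difference of the two sides is `(V m - 2 t x)²`.
    nlinarith [sq_nonneg (V m - 2 * t x)]
  rw [EuclideanSpace.real_norm_sq_eq, Finset.mul_sum]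
  refine (Finset.sum_le_sum fun m _ => h1 m).trans ?_
  rw [Finset.sum_add_distrib, ← Finset.mul_sum, ← Finset.mul_sum]
  linarith [sum_setIntegral_sq_le hE hd t]

/-! ### The quotient space -/

theorem norm_sq_toLp {D : Set Plane} {M : ℕ} (v : H1 D) (V : EuclideanSpace ℝ (Fin M)) :
    ‖(WithLp.toLp 2 (v, V) : PotentialPair D M)‖ ^ 2 = ‖v‖ ^ 2 + ‖V‖ ^ 2 :=
  WithLp.prod_norm_sq_eq_of_L2 _

theorem norm_sq_toQuotient_le {D : Set Plane} {M : ℕ} (v : H1 D)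
    (V : EuclideanSpace ℝ (Fin M)) : ‖toQuotient v V‖ ^ 2 ≤ ‖v‖ ^ 2 + ‖V‖ ^ 2 := by
  rw [← norm_sq_toLp]
  exact pow_le_pow_left₀ (norm_nonneg _) (Submodule.Quotient.norm_mk_le (constants D M) _) 2

theorem forall_quotientSpace {D : Set Plane} {M : ℕ} {r : QuotientSpace D M → Prop}
    (h : ∀ v V, r (toQuotient v V)) (p : QuotientSpace D M) : r p := by
  obtain ⟨q, rfl⟩ := Submodule.Quotient.mk_surjective _ p
  exact h q.fst q.snd

/-- A quadratic bound for all representatives descends to the quotient norm. -/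
theorem le_mul_norm_sq_of_forall_rep {D : Set Plane} {M : ℕ} {p : QuotientSpace D M} {a C : ℝ}
    (hC : 0 ≤ C) (h : ∀ v V, toQuotient v V = p → a ≤ C * (‖v‖ ^ 2 + ‖V‖ ^ 2)) :
    a ≤ C * ‖p‖ ^ 2 := by
  -- Attainment of the infimum is avoided: use a representative of norm less than `‖p‖ + ε` and let
  -- `ε` tend to `0`.
  have ht : Tendsto (fun ε : ℝ => C * (‖p‖ + ε) ^ 2) (𝓝[>] 0) (𝓝 (C * ‖p‖ ^ 2)) := by
    have : Continuous fun ε : ℝ => C * (‖p‖ + ε) ^ 2 := by fun_prop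
    simpa using (this.tendsto 0).mono_left nhdsWithin_le_nhds
  refine ge_of_tendsto ht ?_
  filter_upwards [self_mem_nhdsWithin] with ε hε
  obtain ⟨q, hq, hlt⟩ := Submodule.Quotient.norm_mk_lt p hε
  refine (h q.fst q.snd hq).trans (mul_le_mul_of_nonneg_left ?_ hC)
  rw [← norm_sq_toLp]
  exact pow_le_pow_left₀ (norm_nonneg _) hlt.le 2

/-- The pair `(c, c𝟏)` does not change the class. -/
theorem toQuotient_sub_const {D : Set Plane} {M : ℕ}
    [IsFiniteMeasure ((volume : Measure Plane).restrict D)] (v : H1 D)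
    (V : EuclideanSpace ℝ (Fin M)) (c : ℝ) :
    toQuotient (v - constH1 D c) (WithLp.toLp 2 fun m => V m - c) = toQuotient v V := by
  refine (Submodule.Quotient.eq _).2 ⟨-c, ?_, ?_, fun m => ?_⟩
  · change ∀ᵐ x ∂(volume.restrict D), fn (v - constH1 D c - v) x = -c
    have : v - constH1 D c - v = (-1 : ℝ) • constH1 D c := by module
    rw [this, fn_smul, fn_constH1]
    filter_upwards [Lp.coeFn_smul (-1 : ℝ) (Lp.const 2 (volume.restrict D) c),
      Lp.coeFn_const 2 (volume.restrict D) c] with x hx hx'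
    rw [hx, Pi.smul_apply, hx']
    simp
  · change grad (v - constH1 D c - v) = 0
    rw [grad_sub, grad_sub, grad_constH1]
    simp
  · change V m - c - V m = -c
    ring

/-- The arithmetic of coercivity. Here `a = ‖v‖²`, `b = |V|²`, `G = ‖∇v‖²`, `A` and `Q` are the
conductive and contact energies, and `c, d, r, T, C` stand for `ς₋, ω, ζ₊, C_tr², C_P²`. Eliminating
`b` and then `a` leaves one coefficient for each energy. -/
theorem le_max_mul_add {c d r T C a b G A Q : ℝ} (hc : 0 < c) (hd : 0 < d) (hT : 0 ≤ T)
    (hC : 0 ≤ C) (hG : 0 ≤ G) (hA : c * G ≤ A) (hQ : 0 ≤ Q) (ha : a ≤ C * G)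
    (hb : d * b ≤ 2 * (r * Q) + 2 * (T * a)) :
    a + b ≤ max (C / c * (1 + 2 * T / d)) (2 * r / d) * (A + Q) := by
  have hA0 : 0 ≤ A := (mul_nonneg hc.le hG).trans hA
  have h1 : b ≤ (2 * (r * Q) + 2 * (T * a)) / d := by
    rw [le_div_iff₀ hd]
    linarith
  have h2 : a ≤ C / c * A := by
    rw [div_mul_eq_mul_div, le_div_iff₀ hc]
    linarith [mul_le_mul_of_nonneg_left hA hC, mul_le_mul_of_nonneg_right ha hc.le]
  have hT' : 0 ≤ 1 + 2 * T / d := by positivity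
  rw [mul_add]
  calc a + b ≤ a + (2 * (r * Q) + 2 * (T * a)) / d := by linarith
    _ = (1 + 2 * T / d) * a + 2 * r / d * Q := by ring
    _ ≤ (1 + 2 * T / d) * (C / c * A) + 2 * r / d * Q := by
        linarith [mul_le_mul_of_nonneg_left h2 hT']
    _ = C / c * (1 + 2 * T / d) * A + 2 * r / d * Q := by ring
    _ ≤ _ := add_le_add (mul_le_mul_of_nonneg_right (le_max_left _ _) hA0)
        (mul_le_mul_of_nonneg_right (le_max_right _ _) hQ)

/-- A positive semidefinite symmetric form is bounded by its bound on the diagonal. -/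
theorem abs_apply_le_of_self_le {E : Type*} [SeminormedAddCommGroup E] [Module ℝ E]
    (B : E →ₗ[ℝ] E →ₗ[ℝ] ℝ) {C : ℝ} (hC : 0 ≤ C) (h0 : ∀ p, 0 ≤ B p p)
    (hs : ∀ p q, B p q = B q p) (hle : ∀ p, B p p ≤ C * ‖p‖ ^ 2) (p q : E) :
    |B p q| ≤ C * ‖p‖ * ‖q‖ := by
  have h1 := LinearMap.BilinForm.apply_mul_apply_le_of_forall_zero_le B h0 p q
  rw [hs q p] at h1
  refine abs_le_of_sq_le_sq (?_ : _ ≤ _) (by positivity)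
  calc B p q ^ 2 ≤ B p p * B q q := by rwa [sq]
    _ ≤ (C * ‖p‖ ^ 2) * (C * ‖q‖ ^ 2) := mul_le_mul (hle p) (hle q) (h0 q) (by positivity)
    _ = (C * ‖p‖ * ‖q‖) ^ 2 := by ring

/-! ### The variational form -/

namespace Setup

variable {Nσ Nγ M : ℕ} (P : Setup Nσ Nγ M)

theorem traceNorm_ne_top (h : P.traceSup ≠ ⊤) (y : Parameter Nσ Nγ M) :
    traceNorm (P.γ y.curve) P.L ≠ ⊤ :=
  ne_top_of_le_ne_top h (P.traceNorm_le y)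

theorem norm_tr_le (h : P.traceSup ≠ ⊤) (y : Parameter Nσ Nγ M) (v : H1 (P.domain y)) :
    ‖P.tr y v‖ ≤ P.traceSup.toReal * ‖v‖ :=
  (norm_trace_le (P.traceNorm_ne_top h y) v).trans (mul_le_mul_of_nonneg_right
    (ENNReal.toReal_mono h (P.traceNorm_le y)) (norm_nonneg _))

theorem norm_sq_tr_le (h : P.traceSup ≠ ⊤) (y : Parameter Nσ Nγ M) (v : H1 (P.domain y)) :
    ‖P.tr y v‖ ^ 2 ≤ P.traceSup.toReal ^ 2 * ‖v‖ ^ 2 := by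
  rw [← mul_pow]
  exact pow_le_pow_left₀ (norm_nonneg _) (P.norm_tr_le h y v) 2

theorem norm_sq_sub_mean_le (h : P.poincareSup ≠ ⊤) (y : Parameter Nσ Nγ M)
    (v : H1 (P.domain y)) :
    ‖v - constH1 (P.domain y) (⨍ x in P.domain y, fn v x)‖ ^ 2 ≤
      P.poincareSup.toReal ^ 2 * ‖grad v‖ ^ 2 := by
  refine (CEM.norm_sq_sub_mean_le (ne_top_of_le_ne_top h (P.poincareConst_le y)) v).trans ?_
  rw [mul_pow]
  exact mul_le_mul_of_nonneg_right (pow_le_pow_left₀ ENNReal.toReal_nonneg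
    (ENNReal.toReal_mono h (P.poincareConst_le y)) 2) (sq_nonneg _)

/-- The gradient on the quotient space. -/
def gradMap (y : Parameter Nσ Nγ M) :
    QuotientSpace (P.domain y) M →ₗ[ℝ] Lp Plane 2 (volume.restrict (P.domain y)) :=
  (constants (P.domain y) M).liftQ
    { toFun := fun p => grad p.fst
      map_add' := fun _ _ => rfl
      map_smul' := fun _ _ => rfl }
    (by
      rintro p ⟨c, -, h, -⟩
      exact h)

/-- The jump `V_m - v` of the potential at the `m`-th electrode, on the quotient space. -/
def jumpMap (h : P.traceSup ≠ ⊤) (y : Parameter Nσ Nγ M) (m : Fin M) :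
    QuotientSpace (P.domain y) M →ₗ[ℝ] Lp ℝ 2 (P.dS y) :=
  (constants (P.domain y) M).liftQ
    { toFun := fun p => Lp.const 2 (P.dS y) (p.snd m) - P.tr y p.fst
      map_add' := fun p q => by
        have h1 : P.tr y (p + q).fst = P.tr y p.fst + P.tr y q.fst :=
          trace_add (P.traceNorm_ne_top h y) _ _
        have h2 : (p + q).snd m = p.snd m + q.snd m := rfl
        rw [h1, h2, map_add]
        abel
      map_smul' := fun c p => by
        have h1 : P.tr y (c • p).fst = c • P.tr y p.fst :=
          trace_smul (P.traceNorm_ne_top h y) _ _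
        have h2 : (c • p).snd m = c • p.snd m := rfl
        have h3 : Lp.const 2 (P.dS y) (c • p.snd m) = c • Lp.const 2 (P.dS y) (p.snd m) :=
          (Lp.constL 2 (P.dS y) ℝ).map_smul c _
        rw [h1, h2, h3, smul_sub]
        rfl }
    (by
      rintro p ⟨c, h1, h2, h3⟩
      -- By uniqueness, the trace of the constant `c` is `c`, which cancels the voltage `c`.
      have h4 : P.tr y p.fst = Lp.const 2 (P.dS y) c :=
        (@isTrace_const _ _ (P.isFiniteMeasure_dS y) _ _ h1 h2).eq_trace (P.traceNorm_ne_top h y)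
      change Lp.const 2 (P.dS y) (p.snd m) - P.tr y p.fst = 0
      rw [h3, h4, sub_self])

theorem jumpMap_toQuotient (h : P.traceSup ≠ ⊤) (y : Parameter Nσ Nγ M) (m : Fin M)
    (v : H1 (P.domain y)) (V : EuclideanSpace ℝ (Fin M)) :
    ∀ᵐ x ∂(P.dS y), P.jumpMap h y m (toQuotient v V) x = V m - P.tr y v x := by
  have h0 : P.jumpMap h y m (toQuotient v V) = Lp.const 2 (P.dS y) (V m) - P.tr y v := rfl
  rw [h0]
  filter_upwards [Lp.coeFn_sub (Lp.const 2 (P.dS y) (V m)) (P.tr y v),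
    Lp.coeFn_const 2 (P.dS y) (V m)] with x hx hx'
  rw [hx, Pi.sub_apply, hx']
  rfl

theorem ae_abs_conductivity_le (y : Parameter Nσ Nγ M) :
    ∀ᵐ x ∂(volume.restrict (P.domain y)), |P.conductivity y x| ≤ P.condMax :=
  P.ae_conductivity (p := fun s => |s| ≤ P.condMax) y (P.abs_le_condMax y.cond)

theorem ae_condMin_le_conductivity (h : P.traceSup ≠ ⊤) (y : Parameter Nσ Nγ M) :
    ∀ᵐ x ∂(volume.restrict (P.domain y)), P.condMin ≤ P.conductivity y x :=
  P.ae_conductivity (p := fun s => P.condMin ≤ s) y (P.condMin_le h y.cond)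

/-- The indicator serves as a weight, so that electrode integrals are weighted forms on the whole
curve. -/
theorem aestronglyMeasurable_indicator (y : Parameter Nσ Nγ M) (m : Fin M) :
    AEStronglyMeasurable ((P.electrode y m).indicator (1 : Plane → ℝ)) (P.dS y) :=
  (stronglyMeasurable_one.indicator (P.measurableSet_electrode y m)).aestronglyMeasurable

theorem ae_abs_indicator_le (y : Parameter Nσ Nγ M) (m : Fin M) :
    ∀ᵐ x ∂(P.dS y), |(P.electrode y m).indicator (1 : Plane → ℝ) x| ≤ 1 := by
  refine ae_of_all _ fun x => ?_
  by_cases hx : x ∈ P.electrode y m <;> simp [hx]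

/-- The variational form of the complete electrode model on the quotient space. -/
def quotientForm (h : P.traceSup ≠ ⊤) (y : Parameter Nσ Nγ M) :
    QuotientSpace (P.domain y) M →ₗ[ℝ] QuotientSpace (P.domain y) M →ₗ[ℝ] ℝ :=
  (weightedForm (P.aestronglyMeasurable_conductivity y) (P.ae_abs_conductivity_le y)).compl₁₂
      (P.gradMap y) (P.gradMap y) +
    ∑ m : Fin M, (1 / P.z y.res m) •
      (weightedForm (P.aestronglyMeasurable_indicator y m) (P.ae_abs_indicator_le y m)).compl₁₂
        (P.jumpMap h y m) (P.jumpMap h y m)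

/-- This is the well-definedness: the formula agrees with a form built on the quotient. -/
theorem quotientForm_toQuotient (h : P.traceSup ≠ ⊤) (y : Parameter Nσ Nγ M)
    (w : H1 (P.domain y)) (W : EuclideanSpace ℝ (Fin M))
    (v : H1 (P.domain y)) (V : EuclideanSpace ℝ (Fin M)) :
    P.quotientForm h y (toQuotient w W) (toQuotient v V) = P.form y w W v V := by
  have h1 : ∀ m, weightedForm (P.aestronglyMeasurable_indicator y m) (P.ae_abs_indicator_le y m)
      (P.jumpMap h y m (toQuotient w W)) (P.jumpMap h y m (toQuotient v V)) =
      ∫ x in P.electrode y m, (W m - P.tr y w x) * (V m - P.tr y v x) ∂(P.dS y) := by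
    intro m
    rw [weightedForm_apply, ← integral_indicator (P.measurableSet_electrode y m)]
    refine integral_congr_ae ?_
    filter_upwards [P.jumpMap_toQuotient h y m w W, P.jumpMap_toQuotient h y m v V] with x hx hx'
    rw [hx, hx']
    by_cases hm : x ∈ P.electrode y m
    · simp [hm, mul_comm]
    · simp [hm]
  simp only [quotientForm, LinearMap.add_apply, LinearMap.sum_apply, LinearMap.smul_apply,
    LinearMap.compl₁₂_apply, h1, smul_eq_mul]
  rfl

theorem form_comm (y : Parameter Nσ Nγ M) (w : H1 (P.domain y)) (W : EuclideanSpace ℝ (Fin M))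
    (v : H1 (P.domain y)) (V : EuclideanSpace ℝ (Fin M)) :
    P.form y w W v V = P.form y v V w W := by
  simp only [form, real_inner_comm, mul_comm]

theorem real_dS_electrode (y : Parameter Nσ Nγ M) (m : Fin M) :
    (P.dS y).real (P.electrode y m) = P.width := by
  rw [Measure.real, P.dS_electrode, ENNReal.toReal_ofReal P.width_pos.le]

theorem setIntegral_jump_sq_nonneg (y : Parameter Nσ Nγ M) (v : H1 (P.domain y))
    (V : EuclideanSpace ℝ (Fin M)) (m : Fin M) :
    0 ≤ ∫ x in P.electrode y m, (V m - P.tr y v x) * (V m - P.tr y v x) ∂(P.dS y) :=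
  integral_nonneg fun _ => mul_self_nonneg _

theorem form_self_nonneg (h : P.traceSup ≠ ⊤) (y : Parameter Nσ Nγ M) (v : H1 (P.domain y))
    (V : EuclideanSpace ℝ (Fin M)) : 0 ≤ P.form y v V v V := by
  refine add_nonneg ?_ (Finset.sum_nonneg fun m _ => mul_nonneg
    (one_div_nonneg.2 (P.z_pos _ _).le) (P.setIntegral_jump_sq_nonneg y v V m))
  exact (mul_nonneg (P.condMin_pos h).le (sq_nonneg _)).trans
    (mul_norm_sq_le_integral (P.aestronglyMeasurable_conductivity y) (P.ae_abs_conductivity_le y)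
      (P.ae_condMin_le_conductivity h y) (grad v))

/-- The gradient term costs at most `ς₊ ‖v‖²`, the jumps at most `(2 ω |V|² + 2 C_tr² ‖v‖²) / ζ₋`;
the maximum is over the coefficients of `‖v‖²` and `|V|²`. -/
theorem form_self_le (h : P.traceSup ≠ ⊤) (y : Parameter Nσ Nγ M) (v : H1 (P.domain y))
    (V : EuclideanSpace ℝ (Fin M)) :
    P.form y v V v V ≤ max (P.condMax + 2 * P.traceSup.toReal ^ 2 / P.resMin)
      (2 * P.width / P.resMin) * (‖v‖ ^ 2 + ‖V‖ ^ 2) := by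
  have hz := P.resMin_pos
  have h1 := integral_le_mul_norm_sq (P.aestronglyMeasurable_conductivity y)
    (P.ae_abs_conductivity_le y) (grad v)
  have h2 : P.condMax * ‖grad v‖ ^ 2 ≤ P.condMax * ‖v‖ ^ 2 := by
    refine mul_le_mul_of_nonneg_left ?_ P.condMax_nonneg
    rw [norm_sq_H1]
    linarith [sq_nonneg ‖fn v‖]
  have h3 : ∑ m : Fin M, 1 / P.z y.res m *
      ∫ x in P.electrode y m, (V m - P.tr y v x) * (V m - P.tr y v x) ∂(P.dS y) ≤
      1 / P.resMin * (2 * P.width * ‖V‖ ^ 2 + 2 * (P.traceSup.toReal ^ 2 * ‖v‖ ^ 2)) := by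
    calc _ ≤ ∑ m : Fin M, 1 / P.resMin *
          ∫ x in P.electrode y m, (V m - P.tr y v x) * (V m - P.tr y v x) ∂(P.dS y) :=
          Finset.sum_le_sum fun m _ => mul_le_mul_of_nonneg_right
            (one_div_le_one_div_of_le hz (P.resMin_le _ _)) (P.setIntegral_jump_sq_nonneg y v V m)
      _ ≤ _ := by
          rw [← Finset.mul_sum]
          refine mul_le_mul_of_nonneg_left ?_ (one_div_nonneg.2 hz.le)
          have := sum_electrode_le (P.measurableSet_electrode y) (P.pairwise_disjoint_electrode y)
            (P.real_dS_electrode y) (P.tr y v) V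
          linarith [P.norm_sq_tr_le h y v]
  have h4 := mul_le_mul_of_nonneg_right (le_max_left (P.condMax + 2 * P.traceSup.toReal ^ 2 /
    P.resMin) (2 * P.width / P.resMin)) (sq_nonneg ‖v‖)
  have h5 := mul_le_mul_of_nonneg_right (le_max_right (P.condMax + 2 * P.traceSup.toReal ^ 2 /
    P.resMin) (2 * P.width / P.resMin)) (sq_nonneg ‖V‖)
  calc P.form y v V v V ≤ P.condMax * ‖v‖ ^ 2 +
        1 / P.resMin * (2 * P.width * ‖V‖ ^ 2 + 2 * (P.traceSup.toReal ^ 2 * ‖v‖ ^ 2)) :=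
        add_le_add (h1.trans h2) h3
    _ = (P.condMax + 2 * P.traceSup.toReal ^ 2 / P.resMin) * ‖v‖ ^ 2 +
        2 * P.width / P.resMin * ‖V‖ ^ 2 := by ring
    _ ≤ _ := by
        rw [mul_add]
        exact add_le_add h4 h5

theorem integral_conductivity_ge (h : P.traceSup ≠ ⊤) (y : Parameter Nσ Nγ M)
    (v : H1 (P.domain y)) : P.condMin * ‖grad v‖ ^ 2 ≤
      ∫ x in P.domain y, P.conductivity y x * inner ℝ (grad v x) (grad v x) :=
  mul_norm_sq_le_integral (P.aestronglyMeasurable_conductivity y) (P.ae_abs_conductivity_le y)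
    (P.ae_condMin_le_conductivity h y) (grad v)

theorem width_mul_norm_sq_le (h : P.traceSup ≠ ⊤) (y : Parameter Nσ Nγ M) (v : H1 (P.domain y))
    (V : EuclideanSpace ℝ (Fin M)) :
    P.width * ‖V‖ ^ 2 ≤ 2 * (P.resMax * ∑ m : Fin M, 1 / P.z y.res m *
      ∫ x in P.electrode y m, (V m - P.tr y v x) * (V m - P.tr y v x) ∂(P.dS y)) +
      2 * (P.traceSup.toReal ^ 2 * ‖v‖ ^ 2) := by
  have h2 : ∑ m : Fin M,
      ∫ x in P.electrode y m, (V m - P.tr y v x) * (V m - P.tr y v x) ∂(P.dS y) ≤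
      P.resMax * ∑ m : Fin M, 1 / P.z y.res m *
        ∫ x in P.electrode y m, (V m - P.tr y v x) * (V m - P.tr y v x) ∂(P.dS y) := by
    rw [Finset.mul_sum]
    refine Finset.sum_le_sum fun m _ => ?_
    rw [← mul_assoc]
    -- Each weight becomes at least `1` after multiplication by `ζ₊`, since `z_m ≤ ζ₊`.
    refine le_mul_of_one_le_left (P.setIntegral_jump_sq_nonneg y v V m) ?_
    rw [mul_one_div, one_le_div (P.z_pos _ _)]
    exact P.le_resMax _ _
  have h3 := voltage_norm_sq_le (P.measurableSet_electrode y) (P.pairwise_disjoint_electrode y)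
    (P.real_dS_electrode y) (P.tr y v) V
  linarith [P.norm_sq_tr_le h y v]

/-- Coercivity of the form on pairs that satisfy the Poincaré–Wirtinger inequality. -/
theorem norm_sq_le_form_self (h : P.traceSup ≠ ⊤) (y : Parameter Nσ Nγ M) {v : H1 (P.domain y)}
    (hv : ‖v‖ ^ 2 ≤ P.poincareSup.toReal ^ 2 * ‖grad v‖ ^ 2) (V : EuclideanSpace ℝ (Fin M)) :
    ‖v‖ ^ 2 + ‖V‖ ^ 2 ≤
      max (P.poincareSup.toReal ^ 2 / P.condMin * (1 + 2 * P.traceSup.toReal ^ 2 / P.width))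
        (2 * P.resMax / P.width) * P.form y v V v V := by
  refine le_max_mul_add (P.condMin_pos h) P.width_pos (sq_nonneg _) (sq_nonneg _) (sq_nonneg _)
    (P.integral_conductivity_ge h y v) (Finset.sum_nonneg fun m _ => mul_nonneg
      (one_div_nonneg.2 (P.z_pos _ _).le) (P.setIntegral_jump_sq_nonneg y v V m)) hv
    (P.width_mul_norm_sq_le h y v V)

/-! ### The two bounds on the quotient -/

theorem quotientForm_self_nonneg (h : P.traceSup ≠ ⊤) (y : Parameter Nσ Nγ M)
    (p : QuotientSpace (P.domain y) M) : 0 ≤ P.quotientForm h y p p := by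
  refine forall_quotientSpace (r := fun p => 0 ≤ P.quotientForm h y p p) (fun v V => ?_) p
  exact (P.form_self_nonneg h y v V).trans_eq (P.quotientForm_toQuotient h y v V v V).symm

theorem quotientForm_comm (h : P.traceSup ≠ ⊤) (y : Parameter Nσ Nγ M)
    (p q : QuotientSpace (P.domain y) M) :
    P.quotientForm h y p q = P.quotientForm h y q p := by
  refine forall_quotientSpace
    (r := fun p => P.quotientForm h y p q = P.quotientForm h y q p) (fun v V => ?_) p
  refine forall_quotientSpace (r := fun q => P.quotientForm h y (toQuotient v V) q =
    P.quotientForm h y q (toQuotient v V)) (fun w W => ?_) q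
  exact (P.quotientForm_toQuotient h y v V w W).trans ((P.form_comm y v V w W).trans
    (P.quotientForm_toQuotient h y w W v V).symm)

theorem quotientForm_self_le (h : P.traceSup ≠ ⊤) (y : Parameter Nσ Nγ M)
    (p : QuotientSpace (P.domain y) M) :
    P.quotientForm h y p p ≤ max (P.condMax + 2 * P.traceSup.toReal ^ 2 / P.resMin)
      (2 * P.width / P.resMin) * ‖p‖ ^ 2 := by
  have hC : 0 ≤ 2 * P.width / P.resMin :=
    div_nonneg (mul_nonneg zero_le_two P.width_pos.le) P.resMin_pos.le
  refine le_mul_norm_sq_of_forall_rep (hC.trans (le_max_right _ _)) ?_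
  intro v V hp
  have e : P.quotientForm h y p p = P.form y v V v V :=
    (congrArg (fun q => P.quotientForm h y q q) hp.symm).trans
      (P.quotientForm_toQuotient h y v V v V)
  exact e.trans_le (P.form_self_le h y v V)

theorem abs_quotientForm_le (h : P.traceSup ≠ ⊤) (y : Parameter Nσ Nγ M)
    (p q : QuotientSpace (P.domain y) M) :
    |P.quotientForm h y p q| ≤ max (P.condMax + 2 * P.traceSup.toReal ^ 2 / P.resMin)
      (2 * P.width / P.resMin) * ‖p‖ * ‖q‖ :=
  abs_apply_le_of_self_le _ ((div_nonneg (mul_nonneg zero_le_two P.width_pos.le)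
    P.resMin_pos.le).trans (le_max_right _ _)) (P.quotientForm_self_nonneg h y)
    (P.quotientForm_comm h y) (P.quotientForm_self_le h y) p q

theorem form_sub_const (h : P.traceSup ≠ ⊤) (y : Parameter Nσ Nγ M) (v : H1 (P.domain y))
    (V : EuclideanSpace ℝ (Fin M)) (c : ℝ) :
    P.form y (v - constH1 (P.domain y) c) (WithLp.toLp 2 fun m => V m - c)
      (v - constH1 (P.domain y) c) (WithLp.toLp 2 fun m => V m - c) = P.form y v V v V :=
  (P.quotientForm_toQuotient h y _ _ _ _).symm.trans
    ((congrArg (fun q => P.quotientForm h y q q) (toQuotient_sub_const v V c)).trans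
      (P.quotientForm_toQuotient h y v V v V))

/-- Subtracting the mean of `v` from all components changes neither the class nor the form, and the
quotient norm is at most the norm of this representative, to which the Poincaré–Wirtinger inequality
applies. -/
theorem norm_sq_toQuotient_le_form (h : P.traceSup ≠ ⊤) (hP : P.poincareSup ≠ ⊤)
    (y : Parameter Nσ Nγ M) (v : H1 (P.domain y)) (V : EuclideanSpace ℝ (Fin M)) :
    ‖toQuotient v V‖ ^ 2 ≤
      max (P.poincareSup.toReal ^ 2 / P.condMin * (1 + 2 * P.traceSup.toReal ^ 2 / P.width))
        (2 * P.resMax / P.width) * P.form y v V v V := by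
  have hv : ‖v - constH1 (P.domain y) (⨍ x in P.domain y, fn v x)‖ ^ 2 ≤
      P.poincareSup.toReal ^ 2 *
        ‖grad (v - constH1 (P.domain y) (⨍ x in P.domain y, fn v x))‖ ^ 2 :=
    (P.norm_sq_sub_mean_le hP y v).trans_eq
      (congrArg (fun g => P.poincareSup.toReal ^ 2 * ‖g‖ ^ 2) (grad_sub_constH1 v _).symm)
  exact (congrArg (fun q => ‖q‖ ^ 2) (toQuotient_sub_const v V _).symm).trans_le
    ((norm_sq_toQuotient_le _ _).trans ((P.norm_sq_le_form_self h y hv _).trans_eq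
      (congrArg _ (P.form_sub_const h y v V _))))

theorem le_quotientForm_self (h : P.traceSup ≠ ⊤) (hP : P.poincareSup ≠ ⊤)
    (y : Parameter Nσ Nγ M) (p : QuotientSpace (P.domain y) M) :
    (max (P.poincareSup.toReal ^ 2 / P.condMin * (1 + 2 * P.traceSup.toReal ^ 2 / P.width))
      (2 * P.resMax / P.width))⁻¹ * ‖p‖ ^ 2 ≤ P.quotientForm h y p p := by
  -- The second entry alone makes the maximum positive, so it can be inverted even if `C_P` is zero.
  have hpos : 0 < 2 * P.resMax / P.width :=
    div_pos (mul_pos two_pos P.resMax_pos) P.width_pos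
  rw [inv_mul_le_iff₀ (hpos.trans_le (le_max_right _ _))]
  refine forall_quotientSpace (r := fun p => ‖p‖ ^ 2 ≤
    max (P.poincareSup.toReal ^ 2 / P.condMin * (1 + 2 * P.traceSup.toReal ^ 2 / P.width))
      (2 * P.resMax / P.width) * P.quotientForm h y p p) (fun v V => ?_) p
  exact (P.norm_sq_toQuotient_le_form h hP y v V).trans_eq
    (congrArg _ (P.quotientForm_toQuotient h y v V v V).symm)

end Setup

end CEM

end

theorem mainTheorem1 (Nσ Nγ M : ℕ) (P : CEM.Setup Nσ Nγ M)
    (hCtr : P.traceSup ≠ ⊤) (hCP : P.poincareSup ≠ ⊤) :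
    0 < P.condMin ∧ 0 < P.resMin ∧
    ∀ y : CEM.Parameter Nσ Nγ M,
      ∃ B : CEM.QuotientSpace (P.domain y) M →ₗ[ℝ] CEM.QuotientSpace (P.domain y) M →ₗ[ℝ] ℝ,
        (∀ (w : CEM.H1 (P.domain y)) (W : EuclideanSpace ℝ (Fin M))
            (v : CEM.H1 (P.domain y)) (V : EuclideanSpace ℝ (Fin M)),
          B (CEM.toQuotient w W) (CEM.toQuotient v V) = P.form y w W v V) ∧
        (∀ p q : CEM.QuotientSpace (P.domain y) M,
          |B p q| ≤ max (P.condMax + 2 * P.traceSup.toReal ^ 2 / P.resMin)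
            (2 * P.width / P.resMin) * ‖p‖ * ‖q‖) ∧
        (∀ p : CEM.QuotientSpace (P.domain y) M,
          (max (P.poincareSup.toReal ^ 2 / P.condMin * (1 + 2 * P.traceSup.toReal ^ 2 / P.width))
            (2 * P.resMax / P.width))⁻¹ * ‖p‖ ^ 2 ≤ B p p) :=
  ⟨P.condMin_pos hCtr, P.resMin_pos, fun y => ⟨P.quotientForm hCtr y,
    P.quotientForm_toQuotient hCtr y, P.abs_quotientForm_le hCtr y,
    P.le_quotientForm_self hCtr hCP y⟩⟩
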